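/- Let $\Lambda$ be an artin algebra, i.e. an algebra over a commutative artinian ring $k$ that is finitely generated as a $k$-module, and let $\operatorname{mod}\Lambda$ be the category of finitely generated left $\Lambda$-modules. Let $\widetilde Q$ be the direct sum of representatives of the isomorphism classes of all indecomposable projective-injective modules in $\operatorname{mod}\Lambda$. Let $\mathcal C_\Lambda=(\operatorname{Gen}\widetilde Q)\cap(\operatorname{Cogen}\widetilde Q)$ be the full subcategory of $\operatorname{mod}\Lambda$ of all modules $X$ for which there are an epimorphism $\widetilde Q^{m}\to X$ and a monomorphism $X\to\widetilde Q^{n}$ for some $m,n\ge 0$. For a module $T$ let $\operatorname{add}T$ be the class of direct summands of finite direct sums of copies of $T$, and let $D=\operatorname{Hom}_k(-,J)$, where $J$ is the injective envelope of $k/\operatorname{rad}k$. A module $T\in\operatorname{mod}\Lambda$ is called *tilting* if it is basic (a finite direct sum of pairwise non-isomorphic indecomposable modules), $\operatorname{pd}_\Lambda T\le 1$, $\operatorname{Ext}^1_\Lambda(T,T)=0$, and there is an exact sequence $0\to\Lambda\to T_0\to T_1\to 0$ with $T_0,T_1\in\operatorname{add}T$. A module $C\in\operatorname{mod}\Lambda$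 is called *cotilting* if $\operatorname{id}_\Lambda C\le 1$, $\operatorname{Ext}^1_\Lambda(C,C)=0$, and there is an exact sequence $0\to C_0\to C_1\to D\Lambda\to 0$ with $C_0,C_1\in\operatorname{add}C$. The dominant dimension $\operatorname{dom.dim}\Lambda\in\{0,1,2,\dots,\infty\}$ is the supremum of all $d$ such that in a minimal injective resolution $0\to{}_\Lambda\Lambda\to I_0\to I_1\to\cdots$ the modules $I_i$ are projective for all $0\le i<d$. **Theorem.** The following are equivalent: 1. $\Lambda$ is $1$-Auslander–Gorenstein, i.e. $\operatorname{id}{}_\Lambda\Lambda\le 2\le\operatorname{dom.dim}\Lambda$; 2. $\mathcal C_\Lambda$ contains a module that is both tilting and cotilting. -/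

import Mathlib

open CategoryTheory

universe u

namespace ArtinAlgebra

section Modules

variable {R : Type u} [Ring R]

/-- A submodule `N` of `M` is essential if it meets every nonzero submodule of `M` nontrivially. -/
def IsEssential {M : Type u} [AddCommGroup M] [Module R M] (N : Submodule R M) : Prop :=
  ∀ L : Submodule R M, N ⊓ L = ⊥ → L = ⊥

/-- `E` is an injective envelope of `M`: it is injective and contains an essential copy of `M`. -/
def IsInjectiveEnvelope (M E : Type u) [AddCommGroup M] [Module R M]
    [AddCommGroup E] [Module R E] : Prop :=
  Module.Injective R E ∧
    ∃ f : M →ₗ[R] E, Function.Injective f ∧ IsEssential (LinearMap.range f)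

/-- `M` is generated by `X`: there is an epimorphism `X ^ m → M` for some `m`. -/
def IsGeneratedBy (X M : ModuleCat.{u} R) : Prop :=
  ∃ (m : ℕ) (f : (Fin m → X) →ₗ[R] M), Function.Surjective f

/-- `M` is cogenerated by `X`: there is a monomorphism `M → X ^ m` for some `m`. -/
def IsCogeneratedBy (X M : ModuleCat.{u} R) : Prop :=
  ∃ (m : ℕ) (f : M →ₗ[R] (Fin m → X)), Function.Injective f

/-- `M` lies in `add X`: it is a direct summand of `X ^ m` for some `m`. -/
def IsInAdd (X M : ModuleCat.{u} R) : Prop :=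
  ∃ m : ℕ, Nonempty (Retract M (ModuleCat.of R (Fin m → X)))

/-- `M` is basic: it is a finite direct sum of pairwise non-isomorphic indecomposable modules. -/
def IsBasic (M : ModuleCat.{u} R) : Prop :=
  ∃ (n : ℕ) (N : Fin n → ModuleCat.{u} R),
    (∀ i, Indecomposable (N i)) ∧
    (∀ i j, Nonempty (N i ≅ N j) → i = j) ∧
    Nonempty (M ≅ ModuleCat.of R (∀ i, N i))

/-- `M` is an indecomposable finitely generated projective-injective module. -/
def IsIndecProjInj (M : ModuleCat.{u} R) : Prop :=
  Module.Finite R M ∧ Indecomposable M ∧ Projective M ∧ Injective M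

/-- `Q` is the direct sum of representatives of the isomorphism classes of all indecomposable
projective-injective modules (each class being represented exactly once). -/
def IsSumOfProjInj (Q : ModuleCat.{u} R) : Prop :=
  ∃ (t : ℕ) (P : Fin t → ModuleCat.{u} R),
    (∀ i, IsIndecProjInj (P i)) ∧
    (∀ i j, Nonempty (P i ≅ P j) → i = j) ∧
    (∀ M : ModuleCat.{u} R, IsIndecProjInj M → ∃ i, Nonempty (M ≅ P i)) ∧
    Nonempty (Q ≅ ModuleCat.of R (∀ i, P i))

/-- `M` belongs to the subcategory `Gen Q ∩ Cogen Q` of the finitely generated modules, where `Q`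
is the direct sum of representatives of the indecomposable projective-injective modules. -/
def IsInC (M : ModuleCat.{u} R) : Prop :=
  Module.Finite R M ∧
    ∃ Q : ModuleCat.{u} R, IsSumOfProjInj Q ∧ IsGeneratedBy Q M ∧ IsCogeneratedBy Q M

/-- `T` is a (classical, basic) tilting module. -/
structure IsTilting (T : ModuleCat.{u} R) : Prop where
  finite : Module.Finite R T
  basic : IsBasic T
  projectiveDimension_le : projectiveDimension T ≤ 1
  ext_self : Subsingleton (Abelian.Ext T T 1)
  exists_coresolution : ∃ (T₀ T₁ : ModuleCat.{u} R) (f : R →ₗ[R] T₀) (g : T₀ →ₗ[R] T₁),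
    IsInAdd T T₀ ∧ IsInAdd T T₁ ∧
    Function.Injective f ∧ Function.Exact f g ∧ Function.Surjective g

/-- An injective resolution `0 → M → I⁰ → I¹ → ⋯` is minimal if every `ker (Iⁿ → Iⁿ⁺¹)`
is essential in `Iⁿ`, that is, `Iⁿ` is an injective envelope of the `n`-th cosyzygy. -/
def IsMinimalResolution {M : ModuleCat.{u} R} (I : InjectiveResolution M) : Prop :=
  ∀ n : ℕ, IsEssential (LinearMap.ker (I.cocomplex.d n (n + 1)).hom)

/-- The dominant dimension of `M`: the supremum of all `k` such that the first `k` terms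
`I⁰, …, Iᵏ⁻¹` of a minimal injective resolution of `M` are projective. -/
noncomputable def domDim (M : ModuleCat.{u} R) : ℕ∞ :=
  sSup {d : ℕ∞ | ∃ k : ℕ, d = k ∧ ∃ I : InjectiveResolution M,
    IsMinimalResolution I ∧ ∀ i < k, Projective (I.cocomplex.X i)}

end Modules

/-- `R` is `m`-Auslander-Gorenstein: `id R ≤ m + 1 ≤ dom.dim R`, for `R` as a left module. -/
def IsAuslanderGorenstein (R : Type u) [Ring R] (m : ℕ) : Prop :=
  injectiveDimension (ModuleCat.of R R) ≤ ((m + 1 : ℕ) : WithBot ℕ∞) ∧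
    ((m + 1 : ℕ) : ℕ∞) ≤ domDim (ModuleCat.of R R)

section Duality

variable (k : Type u) [CommRing k] {Λ : Type u} [Ring Λ] [Algebra k Λ]

/-- `C` is a cotilting module over the artin `k`-algebra `Λ`. Here `D = Hom_k(-, J)` with `J` an
injective envelope of `k / rad k`, and `DΛ = Hom_k(Λ, J)` is the left `Λ`-module with
`(a • φ) x = φ (x * a)`, which is the module coinduced from `J`. -/
structure IsCotilting (C : ModuleCat.{u} Λ) : Prop where
  finite : Module.Finite Λ C
  injectiveDimension_le : injectiveDimension C ≤ 1
  ext_self : Subsingleton (Abelian.Ext C C 1)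
  exists_resolution : ∃ J : ModuleCat.{u} k,
    IsInjectiveEnvelope (R := k) (k ⧸ Ring.jacobson k) J ∧
    ∃ (C₀ C₁ : ModuleCat.{u} Λ) (f : C₀ →ₗ[Λ] C₁)
      (g : C₁ →ₗ[Λ] (ModuleCat.coextendScalars (algebraMap k Λ)).obj J),
      IsInAdd C C₀ ∧ IsInAdd C C₁ ∧
      Function.Injective f ∧ Function.Exact f g ∧ Function.Surjective g

end Duality

end ArtinAlgebra

/-! From 1 to 2. Let `0 → Λ → I₀ → I₁` start a minimal injective resolution, with `I₀`, `I₁`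
projective-injective, and let `K` be the image of `I₀ → I₁`. The module `T` is a basic module with
`add T = add (I₀ ⊕ K)`. The sequence `0 → Λ → I₀ → K → 0` gives `pd T ≤ 1` and the tilting
coresolution. The sequence `0 → K → I₁ → I₁/K → 0` gives `id T ≤ 1`, since `id Λ ≤ 2` makes `I₁/K`
injective. `Ext¹(T, T)` vanishes because `I₀ ⊕ K` is a quotient of an injective module by `Λ` and
`Ext²(T, Λ) = 0`. The cotilting resolution comes from the epimorphism `I₀ ⊕ I₁ ⊕ I₁ → W = I₀ ⊕ I₁ ⊕
I₁/K` with kernel `K`, once `DΛ ∈ add W` is known.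

That last point amounts to `W` containing every simple module, and is proved by counting
(`false_of_resolutions`). Each indecomposable projective `P_j` has a resolution `0 → P_j → A_j → B_j
→ C_j → 0` by injectives, with `A_j`, `B_j` also projective. If a simple `S` embeds in none of `I₀`,
`I₁`, `I₁/K`, it embeds in none of these terms. The square integer matrix recording the alternating
socle multiplicities then has a zero row, hence a nonzero vector in its kernel. Splitting that
vector into positive and negative parts `b`, `c` and using that injectives are determined by their
socles (`nonempty_equiv_of_homLength_eq`), Schanuel's lemma applied twice
(`nonempty_equiv_of_exact`) makes `⊕ P_j^{b_j}` and `⊕ P_j^{c_j}` stably isomorphic. Counting maps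
to the simple tops gives `b = c`, a contradiction.

From 2 to 1. The coresolution of `Λ` by `add T` and `id T ≤ 1` give `id Λ ≤ 2`. Since `T` is
cogenerated by `Q`, there is an embedding of `Λ` into some `X ∈ add Q`. Every map `X/Λ → DΛ` lifts
to the term `C₁` of the cotilting resolution: lift from the projective module `X`, then correct by a
map through an injective module covering `C₀`. As `DΛ` is a cogenerator and `C₁` embeds in a power
of `Q`, so does `X/Λ`, and the dominant dimension is at least two. -/

namespace ArtinAlgebra

/-! ### Direct summands and Schanuel's lemma -/

section Retracts

variable {R : Type u} [Ring R]

/-- `M` is a retract of `X`, that is, isomorphic to a direct summand of `X`. -/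
def IsRetract (R : Type u) [Ring R] (M X : Type u) [AddCommGroup M] [Module R M]
    [AddCommGroup X] [Module R X] : Prop :=
  ∃ (i : M →ₗ[R] X) (r : X →ₗ[R] M), ∀ x, r (i x) = x

variable {M N X Y : Type u} [AddCommGroup M] [Module R M] [AddCommGroup N] [Module R N]
  [AddCommGroup X] [Module R X] [AddCommGroup Y] [Module R Y]

theorem IsRetract.refl : IsRetract R M M := ⟨LinearMap.id, LinearMap.id, fun _ => rfl⟩

theorem IsRetract.of_equiv (e : M ≃ₗ[R] X) : IsRetract R M X :=
  ⟨e.toLinearMap, e.symm.toLinearMap, fun x => by simp⟩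

theorem IsRetract.trans (h : IsRetract R M X) (h' : IsRetract R X Y) : IsRetract R M Y := by
  obtain ⟨i, r, hr⟩ := h
  obtain ⟨j, s, hs⟩ := h'
  exact ⟨j ∘ₗ i, r ∘ₗ s, fun x => by simp [hs, hr]⟩

theorem IsRetract.prod (h : IsRetract R M X) (h' : IsRetract R N Y) :
    IsRetract R (M × N) (X × Y) := by
  obtain ⟨i, r, hr⟩ := h
  obtain ⟨j, s, hs⟩ := h'
  exact ⟨i.prodMap j, r.prodMap s, fun x => by simp [hs, hr]⟩

theorem IsRetract.fst : IsRetract R M (M × N) :=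
  ⟨LinearMap.inl R M N, LinearMap.fst R M N, fun _ => rfl⟩

theorem IsRetract.snd : IsRetract R N (M × N) :=
  ⟨LinearMap.inr R M N, LinearMap.snd R M N, fun _ => rfl⟩

theorem IsRetract.pi {κ : Type} {F G : κ → Type u} [∀ i, AddCommGroup (F i)] [∀ i, Module R (F i)]
    [∀ i, AddCommGroup (G i)] [∀ i, Module R (G i)] (h : ∀ i, IsRetract R (F i) (G i)) :
    IsRetract R (∀ i, F i) (∀ i, G i) := by
  choose i r hr using h
  exact ⟨LinearMap.pi fun k => i k ∘ₗ LinearMap.proj k, LinearMap.pi fun k => r k ∘ₗ LinearMap.proj k,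
    fun x => by ext k; simp [hr]⟩

/-- Coordinates outside the image of `e` are filled with zero. This extracts a single factor, or one
factor per isomorphism class, from a product. -/
theorem IsRetract.proj_comp {κ κ' : Type} {F : κ → Type u}
    [∀ i, AddCommGroup (F i)] [∀ i, Module R (F i)] (e : κ' → κ) (he : Function.Injective e) :
    IsRetract R (∀ i, F (e i)) (∀ i, F i) := by
  classical
  let r : (∀ i, F i) →ₗ[R] (∀ i, F (e i)) := LinearMap.pi fun k => LinearMap.proj (e k)
  refine ⟨LinearMap.pi fun k => if h : ∃ j, e j = k then
      h.choose_spec ▸ LinearMap.proj h.choose else 0, r, fun x => ?_⟩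
  ext k
  have h : ∃ j, e j = e k := ⟨k, rfl⟩
  simp only [r, LinearMap.pi_apply, LinearMap.proj_apply, h, dif_pos]
  -- Injectivity of `e` identifies any preimage of `e k` with `k`, which removes the transport.
  have key : ∀ (j : κ') (hj : e j = e k), (hj ▸ (LinearMap.proj j : (∀ i, F (e i)) →ₗ[R] F (e j)) :
      (∀ i, F (e i)) →ₗ[R] F (e k)) x = x k := by
    intro j hj
    obtain rfl := he hj
    rfl
  exact key _ h.choose_spec

theorem IsRetract.injective (h : IsRetract R M X) [Module.Injective R X] : Module.Injective R M := by
  obtain ⟨i, r, hr⟩ := h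
  refine ⟨fun A B _ _ _ _ f hf g => ?_⟩
  obtain ⟨h, hh⟩ := Module.Injective.out f hf (i ∘ₗ g)
  exact ⟨r ∘ₗ h, fun x => by simp [hh, hr]⟩

theorem IsRetract.projective (h : IsRetract R M X) [Module.Projective R X] :
    Module.Projective R M := by
  obtain ⟨i, r, hr⟩ := h
  exact Module.Projective.of_split i r (LinearMap.ext hr)

theorem IsRetract.finite (h : IsRetract R M X) [Module.Finite R X] : Module.Finite R M := by
  obtain ⟨i, r, hr⟩ := h
  exact Module.Finite.of_surjective r fun x => ⟨i x, hr x⟩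

theorem isRetract_of_injective [Module.Injective R M] (f : M →ₗ[R] X) (hf : Function.Injective f) :
    IsRetract R M X := by
  obtain ⟨r, hr⟩ := Module.Injective.out f hf LinearMap.id
  exact ⟨f, r, hr⟩

theorem isRetract_of_surjective [Module.Projective R M] (f : X →ₗ[R] M)
    (hf : Function.Surjective f) : IsRetract R M X := by
  obtain ⟨r, hr⟩ := Module.projective_lifting_property f LinearMap.id hf
  exact ⟨r, f, fun x => LinearMap.congr_fun hr x⟩

/-- The complement of a retract. -/
theorem IsRetract.exists_compl (h : IsRetract R M X) :
    ∃ N : Submodule R X, IsRetract R N X ∧ Nonempty (X ≃ₗ[R] M × N) := by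
  obtain ⟨i, r, hr⟩ := h
  let p : X →ₗ[R] LinearMap.ker r := LinearMap.codRestrict _ (LinearMap.id - i ∘ₗ r)
    (fun x => by simp [hr])
  refine ⟨LinearMap.ker r, ⟨Submodule.subtype _, p, fun x => ?_⟩, ⟨LinearEquiv.ofLinearMap (r.prod p)
    (i.coprod (Submodule.subtype _)) ?_ ?_⟩⟩
  · ext; simp [p]
  · ext x <;> simp [p, hr]
  · ext x; simp [p]

instance injective_prod [Module.Injective R M] [Module.Injective R N] :
    Module.Injective R (M × N) := by
  refine ⟨fun A B _ _ _ _ f hf g => ?_⟩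
  obtain ⟨h, hh⟩ := Module.Injective.out f hf (LinearMap.fst R M N ∘ₗ g)
  obtain ⟨h', hh'⟩ := Module.Injective.out f hf (LinearMap.snd R M N ∘ₗ g)
  exact ⟨h.prod h', fun x => by ext <;> simp [hh, hh']⟩

/-- Schanuel's lemma for two maps which factor through each other. -/
theorem nonempty_ker_prod_equiv {W : Type u} [AddCommGroup W] [Module R W]
    (f : X →ₗ[R] W) (g : Y →ₗ[R] W) (h : X →ₗ[R] Y) (h' : Y →ₗ[R] X)
    (hh : ∀ x, g (h x) = f x) (hh' : ∀ y, f (h' y) = g y) :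
    Nonempty ((LinearMap.ker f × Y) ≃ₗ[R] (LinearMap.ker g × X)) := by
  -- The isomorphism sends `(p, y)` to `(y - h (p + h' y), p + h' y)`; its inverse has the same
  -- shape with the two sides exchanged.
  let a : (LinearMap.ker f × Y) →ₗ[R] X :=
    (LinearMap.ker f).subtype ∘ₗ LinearMap.fst R _ _ + h' ∘ₗ LinearMap.snd R _ _
  let b : (LinearMap.ker g × X) →ₗ[R] Y :=
    (LinearMap.ker g).subtype ∘ₗ LinearMap.fst R _ _ + h ∘ₗ LinearMap.snd R _ _
  let A : (LinearMap.ker f × Y) →ₗ[R] LinearMap.ker g :=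
    LinearMap.codRestrict _ (LinearMap.snd R _ _ - h ∘ₗ a) (fun x => by simp [a, hh, hh'])
  let B : (LinearMap.ker g × X) →ₗ[R] LinearMap.ker f :=
    LinearMap.codRestrict _ (LinearMap.snd R _ _ - h' ∘ₗ b) (fun x => by simp [b, hh, hh'])
  refine ⟨LinearEquiv.ofLinearMap (A.prod a) (B.prod b) ?_ ?_⟩
  · refine LinearMap.ext fun x => ?_
    ext <;> simp [A, B, a, b]
  · refine LinearMap.ext fun x => ?_
    ext <;> simp [A, B, a, b]

/-- Schanuel's lemma. -/
theorem nonempty_ker_prod_equiv_of_projective {W : Type u} [AddCommGroup W] [Module R W]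
    [Module.Projective R X] [Module.Projective R Y]
    (f : X →ₗ[R] W) (g : Y →ₗ[R] W) (hf : Function.Surjective f) (hg : Function.Surjective g) :
    Nonempty ((LinearMap.ker f × Y) ≃ₗ[R] (LinearMap.ker g × X)) := by
  obtain ⟨h, hh⟩ := Module.projective_lifting_property g f hg
  obtain ⟨h', hh'⟩ := Module.projective_lifting_property f g hf
  exact nonempty_ker_prod_equiv f g h h' (LinearMap.congr_fun hh) (LinearMap.congr_fun hh')

end Retracts

/-! ### Injective envelopes -/

section Envelopes

variable {R : Type u} [Ring R] {M : Type u} [AddCommGroup M] [Module R M]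

theorem exists_maximal_disjoint (A B : Submodule R M) (h : A ⊓ B = ⊥) :
    ∃ E, B ≤ E ∧ A ⊓ E = ⊥ ∧ ∀ E', E ≤ E' → A ⊓ E' = ⊥ → E' = E := by
  obtain ⟨E, hBE, hE⟩ := zorn_le_nonempty₀ {E : Submodule R M | A ⊓ E = ⊥} (by
    intro c hc hchain y hy
    refine ⟨sSup c, ?_, fun z hz => le_sSup hz⟩
    rw [Set.mem_ofPred_eq, eq_bot_iff]
    intro x hx
    obtain ⟨z, hz, hxz⟩ := (Submodule.mem_sSup_of_directed ⟨y, hy⟩ hchain.directedOn).1 hx.2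
    have := hc hz
    rw [Set.mem_ofPred_eq] at this
    rw [← this]
    exact ⟨hx.1, hxz⟩) B h
  exact ⟨E, hBE, hE.prop, fun E' h1 h2 => le_antisymm (hE.le_of_ge h2 h1) h1⟩

/-- Every submodule `N` of an injective module is essential in some direct summand. -/
theorem exists_retract_essential [Module.Injective R M] (N : Submodule R M) :
    ∃ E : Submodule R M, N ≤ E ∧ IsRetract R E M ∧ ∀ L ≤ E, N ⊓ L = ⊥ → L = ⊥ := by
  -- `L` is maximal among submodules meeting `N` trivially, and `E` is maximal among those
  -- containing `N` and meeting `L` trivially. The projection `E ⊕ L → E` extends to `p : M → M`;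
  -- maximality of `L` gives `p⁻¹ L = L`, and then maximality of `E` gives `p M = E`, so `E` splits
  -- off.
  obtain ⟨L, -, hL, hLmax⟩ := exists_maximal_disjoint N ⊥ (by simp)
  obtain ⟨E, hNE, hE, hEmax⟩ := exists_maximal_disjoint L N (by rw [inf_comm, hL])
  let f : E × L →ₗ[R] M := E.subtype.coprod L.subtype
  have hf : Function.Injective f := by
    rw [← LinearMap.ker_eq_bot, LinearMap.ker_eq_bot']
    rintro ⟨⟨x, hx⟩, ⟨y, hy⟩⟩ hxy
    have hxy' : x = -y := by simpa [f, add_eq_zero_iff_eq_neg] using hxy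
    have h0 : x = 0 := by
      have : x ∈ L ⊓ E := ⟨by rw [hxy']; exact L.neg_mem hy, hx⟩
      rwa [hE, Submodule.mem_bot] at this
    subst h0
    have : y = 0 := by simpa using hxy'.symm
    subst this
    rfl
  obtain ⟨p, hp⟩ := Module.Injective.out f hf (E.subtype ∘ₗ LinearMap.fst R E L)
  have hpE : ∀ x ∈ E, p x = x := fun x hx => by simpa [f] using hp (⟨x, hx⟩, 0)
  have hpL : ∀ x ∈ L, p x = 0 := fun x hx => by simpa [f] using hp (0, ⟨x, hx⟩)
  have hpre : L.comap p = L := by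
    have hle : L ≤ L.comap p := fun x hx => by simp [hpL x hx]
    refine hLmax _ hle (eq_bot_iff.2 fun x hx => ?_)
    have h1 : p x ∈ L := hx.2
    rw [hpE x (hNE hx.1)] at h1
    rw [← hL]
    exact ⟨hx.1, h1⟩
  have hrange : LinearMap.range p = E := by
    refine hEmax _ (fun x hx => ⟨x, hpE x hx⟩) (eq_bot_iff.2 ?_)
    rintro _ ⟨hx, ⟨y, rfl⟩⟩
    have : y ∈ L.comap p := hx
    rw [hpre] at this
    simp [hpL y this]
  refine ⟨E, hNE, ⟨E.subtype, p.codRestrict E (fun x => hrange ▸ ⟨x, rfl⟩), fun x => ?_⟩, ?_⟩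
  · ext
    simpa using hpE x x.2
  · intro P hPE hNP
    -- If `P ≤ E` meets `N` trivially then so does `P + L`, because `L ⊓ E = ⊥`; maximality of `L`
    -- forces `P ≤ L`.
    have h1 : P ⊔ L = L := by
      refine hLmax _ le_sup_right (eq_bot_iff.2 ?_)
      rintro x ⟨hx, hx'⟩
      obtain ⟨a, ha, b, hb, rfl⟩ := Submodule.mem_sup.1 hx'
      have hb0 : b ∈ L ⊓ E := ⟨hb, by simpa using E.sub_mem (hNE hx) (hPE ha)⟩
      rw [hE, Submodule.mem_bot] at hb0
      subst hb0
      rw [← hNP]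
      exact ⟨hx, by simpa using ha⟩
    rw [eq_bot_iff]
    intro x hx
    rw [← hE]
    exact ⟨h1 ▸ Submodule.mem_sup_left hx, hPE hx⟩

theorem exists_isInjectiveEnvelope (M : ModuleCat.{u} R) :
    ∃ E : ModuleCat.{u} R, IsInjectiveEnvelope (R := R) M E := by
  obtain ⟨I, hI, f, hf⟩ := EnoughInjectives.presentation M
  have : Module.Injective R I := Module.injective_module_of_injective_object R I
  have hf' : Function.Injective f.hom := (ModuleCat.mono_iff_injective f).mp hf
  obtain ⟨E, hE, hret, hess⟩ := exists_retract_essential (LinearMap.range f.hom)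
  refine ⟨ModuleCat.of R E, hret.injective, f.hom.codRestrict E (fun x => hE ⟨x, rfl⟩),
    fun x y h => hf' (congrArg Subtype.val h), fun L hL => ?_⟩
  have h1 : L.map E.subtype = ⊥ := by
    refine hess _ (Submodule.map_subtype_le E L) (eq_bot_iff.2 ?_)
    rintro _ ⟨⟨y, rfl⟩, ⟨z, hz, hzy⟩⟩
    have : z ∈ (LinearMap.range (f.hom.codRestrict E (fun x => hE ⟨x, rfl⟩))) ⊓ L :=
      ⟨⟨y, Subtype.ext hzy.symm⟩, hz⟩
    rw [hL, Submodule.mem_bot] at this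
    subst this
    simpa using hzy.symm
  refine eq_bot_iff.2 fun x hx => ?_
  have h2 : (x : I) ∈ L.map E.subtype := ⟨x, hx, rfl⟩
  rw [h1, Submodule.mem_bot] at h2
  exact Subtype.ext h2

variable {N X : Type u} [AddCommGroup N] [Module R N] [AddCommGroup X] [Module R X]

theorem injective_of_essential {f : M →ₗ[R] N} (hf : IsEssential (LinearMap.range f))
    (g : N →ₗ[R] X) (hg : Function.Injective (g ∘ₗ f)) : Function.Injective g := by
  rw [← LinearMap.ker_eq_bot]
  refine hf _ (eq_bot_iff.2 ?_)
  rintro _ ⟨⟨y, rfl⟩, hy⟩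
  have : y = 0 := hg (by simpa using hy)
  simp [this]

/-- An injective envelope of `M` is a retract of every injective module containing `M`. -/
theorem IsInjectiveEnvelope.isRetract (h : IsInjectiveEnvelope (R := R) M N) [Module.Injective R X]
    (f : M →ₗ[R] X) (hf : Function.Injective f) : IsRetract R N X := by
  obtain ⟨hN, i, hi, hess⟩ := h
  obtain ⟨g, hg⟩ := Module.Injective.out i hi f
  refine isRetract_of_injective g (injective_of_essential hess g ?_)
  rwa [show g ∘ₗ i = f from LinearMap.ext hg]

/-- A projective module with a finitely generated essential submodule is finitely generated. -/
theorem finite_of_essential [IsNoetherianRing R] [Module.Finite R M] [Module.Projective R N]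
    (f : M →ₗ[R] N) (hess : IsEssential (LinearMap.range f)) :
    Module.Finite R N := by
  classical
  -- `s` embeds `N` in a free module. The finitely many coordinates in `J` support the image of `M`,
  -- so projecting to them is injective on an essential submodule, hence on `N`.
  obtain ⟨s, hs⟩ := Module.projective_def'.1 (inferInstance : Module.Projective R N)
  obtain ⟨t, ht⟩ := Module.Finite.fg_top (R := R) (M := M)
  let J : Finset N := t.biUnion fun x => (s (f x)).support
  let q : N →ₗ[R] (J → R) := LinearMap.pi fun j => Finsupp.lapply (j : N) ∘ₗ s
  have hsupp : ∀ x j, j ∉ J → s (f x) j = 0 := by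
    intro x j hj
    have : LinearMap.ker (Finsupp.lapply (R := R) (M := R) j ∘ₗ s ∘ₗ f) = ⊤ := by
      rw [eq_top_iff, ← ht, Submodule.span_le]
      intro y hy
      by_contra hne
      exact hj (Finset.mem_biUnion.2 ⟨y, hy, Finsupp.mem_support_iff.2 hne⟩)
    exact LinearMap.mem_ker.1 (this ▸ Submodule.mem_top : x ∈ _)
  have hq : Function.Injective q := by
    rw [← LinearMap.ker_eq_bot]
    refine hess _ (eq_bot_iff.2 ?_)
    rintro _ ⟨⟨y, rfl⟩, hy⟩
    have h1 : s (f y) = 0 := by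
      ext j
      by_cases hj : j ∈ J
      · exact congrFun (LinearMap.mem_ker.1 hy) ⟨j, hj⟩
      · exact hsupp y j hj
    have h2 := LinearMap.congr_fun hs (f y)
    rw [LinearMap.comp_apply, h1, map_zero] at h2
    exact h2.symm
  exact Module.Finite.of_injective q hq

end Envelopes

/-! ### Indecomposable modules of finite length -/

section Indecomposables

variable {R : Type u} [Ring R]

/-- A module is indecomposable if it is nonzero and has no proper decomposition `A ⊕ B`. -/
def IsIndec (R M : Type u) [Ring R] [AddCommGroup M] [Module R M] : Prop :=
  Nontrivial M ∧ ∀ A B : Submodule R M, IsCompl A B → A = ⊥ ∨ B = ⊥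

variable {M N X S : Type u} [AddCommGroup M] [Module R M] [AddCommGroup N] [Module R N]
  [AddCommGroup X] [Module R X] [AddCommGroup S] [Module R S]

/-- Fitting's lemma. -/
theorem IsIndec.nilpotent_or_bijective [IsNoetherian R M] [IsArtinian R M] (h : IsIndec R M)
    (f : Module.End R M) : IsNilpotent f ∨ Function.Bijective f := by
  obtain ⟨n, hn, hn1⟩ := (f.eventually_isCompl_ker_pow_range_pow.and
    (Filter.eventually_ge_atTop 1)).exists
  rcases h.2 _ _ hn with h0 | h0
  · right
    apply IsArtinian.bijective_of_injective_endomorphism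
    rw [← LinearMap.ker_eq_bot, eq_bot_iff, ← h0]
    intro x hx
    obtain ⟨m, rfl⟩ := Nat.exists_eq_add_of_le' hn1
    rw [LinearMap.mem_ker] at hx
    rw [LinearMap.mem_ker, pow_succ, Module.End.mul_apply, hx, map_zero]
  · exact Or.inl ⟨n, LinearMap.range_eq_bot.1 h0⟩

/-- A nilpotent endomorphism cannot fix a nonzero map, so Fitting's lemma leaves only bijectivity.
The next lemma is the dual form. -/
theorem IsIndec.bijective_of_comp_eq_left [IsNoetherian R M] [IsArtinian R M] (h : IsIndec R M)
    (f : Module.End R M) (g : S →ₗ[R] M) (hg : g ≠ 0) (hfg : ∀ x, f (g x) = g x) :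
    Function.Bijective f := by
  refine (h.nilpotent_or_bijective f).resolve_left ?_
  rintro ⟨n, hn⟩
  have key : ∀ (n : ℕ) x, (f ^ n) (g x) = g x := by
    intro n x
    induction n with
    | zero => rfl
    | succ n ih => rw [pow_succ, Module.End.mul_apply, hfg, ih]
  exact hg (LinearMap.ext fun x => by rw [← key n x, hn]; rfl)

theorem IsIndec.bijective_of_comp_eq_right [IsNoetherian R M] [IsArtinian R M] (h : IsIndec R M)
    (f : Module.End R M) (g : M →ₗ[R] S) (hg : g ≠ 0) (hfg : ∀ x, g (f x) = g x) :
    Function.Bijective f := by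
  refine (h.nilpotent_or_bijective f).resolve_left ?_
  rintro ⟨n, hn⟩
  have key : ∀ (n : ℕ) x, g ((f ^ n) x) = g x := by
    intro n
    induction n with
    | zero => exact fun x => rfl
    | succ n ih => intro x; rw [pow_succ, Module.End.mul_apply, ih, hfg]
  exact hg (LinearMap.ext fun x => by rw [← key n x, hn]; simp)

theorem isRetract_of_bijective_comp (f : M →ₗ[R] X) (g : X →ₗ[R] M)
    (h : Function.Bijective (g ∘ₗ f)) : IsRetract R M X :=
  ⟨f, (LinearEquiv.ofBijective _ h).symm.toLinearMap ∘ₗ g, fun x =>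
    (LinearEquiv.ofBijective _ h).symm_apply_apply x⟩

/-- An indecomposable injective module embeds as a summand in every injective module containing
one of its simple submodules. -/
theorem IsIndec.isRetract_of_injective [IsNoetherian R M] [IsArtinian R M] (h : IsIndec R M)
    [Module.Injective R M] [Module.Injective R X] [IsSimpleModule R S]
    (j : S →ₗ[R] M) (hj : j ≠ 0) (j' : S →ₗ[R] X) (hj' : j' ≠ 0) : IsRetract R M X := by
  -- Each embedding of `S` extends along the other; the composite endomorphism of `M` fixes the copy
  -- of `S`.
  obtain ⟨f, hf⟩ := Module.Injective.out j (LinearMap.injective_of_ne_zero hj) j'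
  obtain ⟨g, hg⟩ := Module.Injective.out j' (LinearMap.injective_of_ne_zero hj') j
  exact isRetract_of_bijective_comp f g
    (h.bijective_of_comp_eq_left (g ∘ₗ f) j hj fun x => by simp [hf, hg])

/-- An indecomposable projective module has only one simple quotient. -/
theorem IsIndec.nonempty_equiv_of_projective [IsNoetherian R M] [IsArtinian R M]
    (h : IsIndec R M) [Module.Projective R M] [IsSimpleModule R S] [IsSimpleModule R N]
    (f : M →ₗ[R] S) (hf : f ≠ 0) (g : M →ₗ[R] N) (hg : g ≠ 0) : Nonempty (S ≃ₗ[R] N) := by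
  by_contra hne
  have hsf := LinearMap.surjective_of_ne_zero hf
  have hsg := LinearMap.surjective_of_ne_zero hg
  -- Otherwise `f` factors through `g` by a nonzero map between simple modules.
  have hker : ¬ LinearMap.ker g ≤ LinearMap.ker f := by
    intro hle
    let e := g.quotKerEquivOfSurjective hsg
    let φ : N →ₗ[R] S := (LinearMap.ker g).liftQ f hle ∘ₗ e.symm.toLinearMap
    have hφ : φ ≠ 0 := by
      intro h0
      refine hf (LinearMap.ext fun x => ?_)
      have := LinearMap.congr_fun h0 (g x)
      have he : e.symm (g x) = Submodule.Quotient.mk x := by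
        rw [LinearEquiv.symm_apply_eq]; rfl
      simpa [φ, he] using this
    exact hne ⟨(LinearEquiv.ofBijective φ (LinearMap.bijective_of_ne_zero hφ)).symm⟩
  have hr : f ∘ₗ (LinearMap.ker g).subtype ≠ 0 := by
    intro h0
    exact hker fun x hx => LinearMap.congr_fun h0 ⟨x, hx⟩
  -- Since `f` stays surjective on `ker g`, it lifts to `u : M → ker g`. As an endomorphism of `M`,
  -- `u` satisfies `f ∘ u = f` and is therefore bijective, so `ker g` is all of `M`.
  obtain ⟨u, hu⟩ := Module.projective_lifting_property (f ∘ₗ (LinearMap.ker g).subtype) f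
    (LinearMap.surjective_of_ne_zero hr)
  have hb := h.bijective_of_comp_eq_right ((LinearMap.ker g).subtype ∘ₗ u) f hf
    (fun x => LinearMap.congr_fun hu x)
  refine hg (LinearMap.ext fun x => ?_)
  obtain ⟨y, rfl⟩ := hb.2 x
  exact (u y).2

theorem IsRetract.nonempty_equiv_of_isIndec (h : IsRetract R M X) (hX : IsIndec R X)
    [Nontrivial M] : Nonempty (M ≃ₗ[R] X) := by
  obtain ⟨i, r, hr⟩ := h
  have hc : IsCompl (LinearMap.range i) (LinearMap.ker r) := by
    constructor
    · rw [disjoint_iff, eq_bot_iff]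
      rintro _ ⟨⟨x, rfl⟩, hx⟩
      have : x = 0 := by simpa [hr] using hx
      simp [this]
    · rw [codisjoint_iff, eq_top_iff]
      intro x _
      exact Submodule.mem_sup.2 ⟨i (r x), ⟨_, rfl⟩, x - i (r x), by simp [hr], by simp⟩
  have hi : Function.Injective i := Function.LeftInverse.injective hr
  rcases hX.2 _ _ hc with h0 | h0
  · obtain ⟨x, hx⟩ := exists_ne (0 : M)
    exact (hx (hi (by simp [LinearMap.range_eq_bot.1 h0]))).elim
  · refine ⟨LinearEquiv.ofBijective i ⟨hi, ?_⟩⟩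
    rw [← LinearMap.range_eq_top]
    simpa [h0] using hc.sup_eq_top

/-- An indecomposable summand of a finite product is a summand of one of the factors. -/
theorem IsIndec.exists_isRetract_of_pi [IsNoetherian R M] [IsArtinian R M] (h : IsIndec R M)
    {κ : Type} [Finite κ] {F : κ → Type u} [∀ i, AddCommGroup (F i)] [∀ i, Module R (F i)]
    (hM : IsRetract R M (∀ i, F i)) : ∃ k, IsRetract R M (F k) := by
  classical
  cases nonempty_fintype κ
  obtain ⟨i, r, hr⟩ := hM
  let f : κ → Module.End R M := fun k =>
    (r ∘ₗ LinearMap.single R F k) ∘ₗ (LinearMap.proj k ∘ₗ i)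
  have hsum : ∑ k, f k = 1 := by
    ext x
    have : ∑ k, Pi.single k (i x k) = i x := Finset.univ_sum_single (i x)
    simp only [f, LinearMap.sum_apply, LinearMap.comp_apply, LinearMap.proj_apply,
      LinearMap.single_apply, ← map_sum, this, hr, Module.End.one_apply]
  have hunit : ∀ g : Module.End R M, IsNilpotent g ∨ IsUnit g := fun g => by
    rw [Module.End.isUnit_iff]
    exact h.nilpotent_or_bijective g
  have := h.1
  -- The endomorphism ring is local: a sum of nonunits is not a unit. As the `f k` add up to `1`,
  -- one of them is invertible.
  have key : ∀ s : Finset κ, (∃ k ∈ s, IsUnit (f k)) ∨ ¬ IsUnit (∑ k ∈ s, f k) := by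
    intro s
    induction s using Finset.induction_on with
    | empty => simp
    | insert a s ha ih =>
      rcases ih with ⟨k, hk, hb⟩ | hb
      · exact Or.inl ⟨k, Finset.mem_insert_of_mem hk, hb⟩
      rcases hunit (f a) with hn | hba
      swap
      · exact Or.inl ⟨a, Finset.mem_insert_self _ _, hba⟩
      right
      rw [Finset.sum_insert ha]
      rintro ⟨v, hv⟩
      have hnil : IsNilpotent ((↑v⁻¹ : Module.End R M) * f a) := by
        refine (hunit _).resolve_right fun hu => ?_
        have hu2 := (Units.isUnit v).mul hu
        rw [← mul_assoc, Units.mul_inv, one_mul] at hu2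
        obtain ⟨n, hn⟩ := hn
        exact not_isUnit_zero (hn ▸ hu2.pow n)
      have h1 : (↑v⁻¹ : Module.End R M) * ∑ k ∈ s, f k = 1 - (↑v⁻¹ : Module.End R M) * f a := by
        rw [eq_sub_iff_add_eq, ← mul_add, add_comm, ← hv, Units.inv_mul]
      have h2 := (Units.isUnit v).mul (h1 ▸ hnil.isUnit_one_sub)
      rw [← mul_assoc, Units.mul_inv, one_mul] at h2
      exact hb h2
  rcases key Finset.univ with ⟨k, -, hk⟩ | hk
  · exact ⟨k, isRetract_of_bijective_comp _ _ ((Module.End.isUnit_iff _).1 hk)⟩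
  · exact (hk (hsum ▸ isUnit_one)).elim

/-- A module of finite length is a finite product of indecomposable modules. -/
theorem exists_equiv_pi_isIndec (M : ModuleCat.{u} R) [IsNoetherian R M] [IsArtinian R M] :
    ∃ (n : ℕ) (N : Fin n → ModuleCat.{u} R), (∀ i, IsIndec R (N i)) ∧
      Nonempty (M ≃ₗ[R] ∀ i, N i) := by
  suffices H : ∃ (κ : Type) (_ : Fintype κ) (N : κ → ModuleCat.{u} R), (∀ i, IsIndec R (N i)) ∧
      Nonempty (M ≃ₗ[R] ∀ i, N i) by
    obtain ⟨κ, _, N, hN, ⟨e⟩⟩ := H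
    let σ := Fintype.equivFin κ
    exact ⟨Fintype.card κ, fun i => N (σ.symm i), fun i => hN _,
      ⟨e.trans (LinearEquiv.piCongrLeft' R (fun i => N i) σ)⟩⟩
  induction h : Module.length R M using WellFoundedLT.induction generalizing M with
  | ind n ih =>
  subst h
  rcases subsingleton_or_nontrivial M with hs | hs
  · exact ⟨PEmpty, inferInstance, fun i => i.elim, fun i => i.elim,
      ⟨⟨0, 0, fun x => Subsingleton.elim _ _, fun x => Subsingleton.elim _ _⟩⟩⟩
  by_cases hM : IsIndec R M
  · exact ⟨Unit, inferInstance, fun _ => M, fun _ => hM,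
      ⟨(LinearEquiv.funUnique Unit R M).symm⟩⟩
  obtain ⟨A, B, hAB, hA, hB⟩ : ∃ A B : Submodule R M, IsCompl A B ∧ A ≠ ⊥ ∧ B ≠ ⊥ := by
    by_contra! hcon
    exact hM ⟨hs, fun A B hAB => or_iff_not_imp_left.2 (hcon A B hAB)⟩
  let e := Submodule.prodEquivOfIsCompl A B hAB
  have hlen : Module.length R M = Module.length R A + Module.length R B := by
    rw [← e.length_eq, Module.length_prod]
  have hfin : ∀ C : Submodule R M, Module.length R C ≠ ⊤ := fun C =>
    Module.length_ne_top_iff.2 (isFiniteLength_iff_isNoetherian_isArtinian.2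
      ⟨inferInstance, inferInstance⟩)
  have hpos : ∀ C : Submodule R M, C ≠ ⊥ → 0 < Module.length R C := fun C hC =>
    haveI := Submodule.nontrivial_iff_ne_bot.2 hC
    Module.length_pos
  obtain ⟨κ, _, N, hN, ⟨f⟩⟩ := ih (Module.length R A) (by
    rw [hlen]; simpa using (ENat.add_lt_add_iff_left (hfin A)).2 (hpos B hB)) (ModuleCat.of R A) rfl
  obtain ⟨κ', _, N', hN', ⟨f'⟩⟩ := ih (Module.length R B) (by
    rw [hlen, add_comm]; simpa using (ENat.add_lt_add_iff_left (hfin B)).2 (hpos A hA)) (ModuleCat.of R B) rfl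
  refine ⟨κ ⊕ κ', inferInstance, Sum.elim N N', ?_, ⟨?_⟩⟩
  · rintro (i | i)
    · exact hN i
    · exact hN' i
  · exact (e.symm.trans (f.prodCongr f')).trans
      (LinearEquiv.sumPiEquivProdPi R κ κ' (fun i => (Sum.elim N N' i : ModuleCat.{u} R))).symm

theorem indecomposable_iff (M : ModuleCat.{u} R) : Indecomposable M ↔ IsIndec R M := by
  constructor
  · rintro ⟨h0, h⟩
    refine ⟨not_subsingleton_iff_nontrivial.1 fun hs => h0 (ModuleCat.isZero_of_subsingleton M),
      fun A B hAB => ?_⟩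
    refine (h (ModuleCat.of R A) (ModuleCat.of R B)
      ((Submodule.prodEquivOfIsCompl A B hAB).symm.toModuleIso ≪≫
        (ModuleCat.biprodIsoProd (ModuleCat.of R A) (ModuleCat.of R B)).symm)).imp ?_ ?_
    all_goals
      intro hz
      rw [ModuleCat.isZero_iff_subsingleton] at hz
      exact (Submodule.subsingleton_iff_eq_bot).1 hz
  · rintro ⟨hn, h⟩
    refine ⟨fun hz => ?_, fun Y Z e => ?_⟩
    · rw [ModuleCat.isZero_iff_subsingleton] at hz
      exact not_subsingleton M hz
    · let f : M ≃ₗ[R] Y × Z := e.toLinearEquiv.trans (ModuleCat.biprodIsoProd Y Z).toLinearEquiv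
      have hc : IsCompl ((LinearMap.range (LinearMap.inl R Y Z)).map f.symm.toLinearMap)
          ((LinearMap.range (LinearMap.inr R Y Z)).map f.symm.toLinearMap) :=
        (Submodule.orderIsoMapComap f.symm).isCompl (LinearMap.isCompl_range_inl_inr)
      refine (h _ _ hc).imp ?_ ?_
      all_goals
        intro h0
        rw [ModuleCat.isZero_iff_subsingleton]
        refine subsingleton_of_forall_eq 0 fun y => ?_
        have h1 := (Submodule.eq_bot_iff _).1 h0 _ ⟨_, ⟨y, rfl⟩, rfl⟩
        simpa using h1

/-- Choice of representatives of the isomorphism classes in a finite family. -/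
theorem exists_representatives {n : ℕ} (N : Fin n → ModuleCat.{u} R) (p : Fin n → Prop) :
    ∃ (t : ℕ) (e : Fin t → Fin n), (∀ j, p (e j)) ∧
      (∀ i j, Nonempty (N (e i) ≅ N (e j)) → i = j) ∧
      ∀ i, p i → ∃ j, Nonempty (N i ≅ N (e j)) := by
  classical
  let s : Setoid {i // p i} :=
    { r := fun i j => Nonempty (N i ≅ N j)
      iseqv := ⟨fun i => ⟨Iso.refl _⟩, fun ⟨f⟩ => ⟨f.symm⟩, fun ⟨f⟩ ⟨g⟩ => ⟨f ≪≫ g⟩⟩ }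
  let σ := Fintype.equivFin (Quotient s)
  refine ⟨Fintype.card (Quotient s), fun j => (σ.symm j).out, fun j => (σ.symm j).out.2,
    fun i j hij => ?_, fun i hi => ⟨σ (Quotient.mk s ⟨i, hi⟩), ?_⟩⟩
  · have : (σ.symm i).out ≈ (σ.symm j).out := hij
    exact σ.symm.injective (Quotient.out_equiv_out.1 this)
  · have : (⟨i, hi⟩ : {i // p i}) ≈ (σ.symm (σ (Quotient.mk s ⟨i, hi⟩))).out := by
      rw [Equiv.symm_apply_apply]
      exact Setoid.symm (Quotient.mk_out _)
    exact this

end Indecomposables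

/-! ### Lengths of Hom modules and the classification of injectives by their socles -/

section HomLength

variable (k : Type u) [CommRing k] (Λ : Type u) [Ring Λ] [Algebra k Λ]

/-- The type of `Λ`-linear maps, as a module over the base ring `k` of `Λ`. -/
def BaseHom (A B : Type u) [AddCommGroup A] [Module Λ A] [AddCommGroup B] [Module Λ B] : Type u :=
  A →ₗ[Λ] B

variable {A A' B B' : Type u} [AddCommGroup A] [Module Λ A] [AddCommGroup A'] [Module Λ A']
  [AddCommGroup B] [Module Λ B] [AddCommGroup B'] [Module Λ B']

instance : AddCommGroup (BaseHom Λ A B) := inferInstanceAs (AddCommGroup (A →ₗ[Λ] B))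

variable {Λ} in
/-- The action of a scalar of the base ring as a `Λ`-linear map. -/
def baseSMul (r : k) (f : A →ₗ[Λ] B) : A →ₗ[Λ] B where
  toFun x := algebraMap k Λ r • f x
  map_add' x y := by rw [map_add, smul_add]
  map_smul' a x := by
    rw [map_smul, RingHom.id_apply, smul_smul, smul_smul, Algebra.commutes]

/-- Scalars act through their image in `Λ`, which is central. No separate `k`-structure on `A` or
`B` is required. -/
instance : Module k (BaseHom Λ A B) where
  smul r f := baseSMul k (B := B) r f
  one_smul f := LinearMap.ext fun x => by
    change algebraMap k Λ 1 • (show A →ₗ[Λ] B from f) x = _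
    rw [map_one, one_smul]
  mul_smul r s f := LinearMap.ext fun x => by
    change algebraMap k Λ (r * s) • (show A →ₗ[Λ] B from f) x = _
    rw [map_mul, mul_smul]
    rfl
  smul_zero r := LinearMap.ext fun x => smul_zero (M := Λ) (A := B) _
  smul_add r f g := LinearMap.ext fun x => smul_add (M := Λ) (A := B) _ _ _
  add_smul r s f := LinearMap.ext fun x => by
    change algebraMap k Λ (r + s) • (show A →ₗ[Λ] B from f) x = _
    rw [map_add, add_smul]
    rfl
  zero_smul f := LinearMap.ext fun x => by
    change algebraMap k Λ 0 • (show A →ₗ[Λ] B from f) x = _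
    rw [map_zero, zero_smul]
    rfl

/-- The length over `k` of `Hom(A, B)` for two `Λ`-modules `A` and `B`. -/
noncomputable def homLength (A B : Type u) [AddCommGroup A] [Module Λ A]
    [AddCommGroup B] [Module Λ B] : ℕ∞ :=
  Module.length k (BaseHom Λ A B)

variable {k Λ}

theorem homLength_congr_left (e : A ≃ₗ[Λ] A') : homLength k Λ A B = homLength k Λ A' B :=
  LinearEquiv.length_eq (M := BaseHom Λ A B) (N := BaseHom Λ A' B)
    { toFun := fun f => (f : A →ₗ[Λ] B) ∘ₗ e.symm.toLinearMap
      invFun := fun f => (f : A' →ₗ[Λ] B) ∘ₗ e.toLinearMap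
      map_add' := fun _ _ => rfl
      map_smul' := fun _ _ => rfl
      left_inv := fun f => LinearMap.ext fun x =>
        congrArg (show A →ₗ[Λ] B from f) (e.symm_apply_apply x)
      right_inv := fun f => LinearMap.ext fun x =>
        congrArg (show A' →ₗ[Λ] B from f) (e.apply_symm_apply x) }

theorem homLength_congr_right (e : B ≃ₗ[Λ] B') : homLength k Λ A B = homLength k Λ A B' :=
  LinearEquiv.length_eq (M := BaseHom Λ A B) (N := BaseHom Λ A B')
    { toFun := fun f => e.toLinearMap ∘ₗ (f : A →ₗ[Λ] B)
      invFun := fun f => e.symm.toLinearMap ∘ₗ (f : A →ₗ[Λ] B')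
      map_add' := fun _ _ => LinearMap.ext fun _ => e.map_add _ _
      map_smul' := fun r _ => LinearMap.ext fun _ => e.map_smul (algebraMap k Λ r) _
      left_inv := fun _ => LinearMap.ext fun _ => e.symm_apply_apply _
      right_inv := fun _ => LinearMap.ext fun _ => e.apply_symm_apply _ }

theorem homLength_prod_left :
    homLength k Λ (A × A') B = homLength k Λ A B + homLength k Λ A' B := by
  rw [homLength, homLength, homLength, ← Module.length_prod]
  exact LinearEquiv.length_eq (M := BaseHom Λ (A × A') B) (N := BaseHom Λ A B × BaseHom Λ A' B)
    { toFun := fun f => ((f : A × A' →ₗ[Λ] B) ∘ₗ LinearMap.inl Λ A A',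
        (f : A × A' →ₗ[Λ] B) ∘ₗ LinearMap.inr Λ A A')
      invFun := fun f => LinearMap.coprod (f.1 : A →ₗ[Λ] B) (f.2 : A' →ₗ[Λ] B)
      map_add' := fun _ _ => rfl
      map_smul' := fun _ _ => rfl
      left_inv := fun f => LinearMap.coprod_comp_inl_inr (f : A × A' →ₗ[Λ] B)
      right_inv := fun f => Prod.ext
        (LinearMap.coprod_inl (f.1 : A →ₗ[Λ] B) (f.2 : A' →ₗ[Λ] B))
        (LinearMap.coprod_inr (f.1 : A →ₗ[Λ] B) (f.2 : A' →ₗ[Λ] B)) }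

theorem homLength_prod_right :
    homLength k Λ A (B × B') = homLength k Λ A B + homLength k Λ A B' := by
  rw [homLength, homLength, homLength, ← Module.length_prod]
  exact LinearEquiv.length_eq (M := BaseHom Λ A (B × B')) (N := BaseHom Λ A B × BaseHom Λ A B')
    { toFun := fun f => (LinearMap.fst Λ B B' ∘ₗ (f : A →ₗ[Λ] B × B'),
        LinearMap.snd Λ B B' ∘ₗ (f : A →ₗ[Λ] B × B'))
      invFun := fun f => LinearMap.prod (f.1 : A →ₗ[Λ] B) (f.2 : A →ₗ[Λ] B')
      map_add' := fun _ _ => rfl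
      map_smul' := fun _ _ => rfl
      left_inv := fun _ => rfl
      right_inv := fun _ => rfl }

theorem homLength_pi_left {κ : Type} [Fintype κ] (F : κ → Type u) [∀ i, AddCommGroup (F i)]
    [∀ i, Module Λ (F i)] :
    homLength k Λ (∀ i, F i) B = ∑ i, homLength k Λ (F i) B := by
  classical
  unfold homLength
  rw [← Module.length_pi_of_fintype]
  exact LinearEquiv.length_eq (M := BaseHom Λ (∀ i, F i) B) (N := ∀ i, BaseHom Λ (F i) B)
    { toFun := fun f i => (f : (∀ i, F i) →ₗ[Λ] B) ∘ₗ LinearMap.single Λ F i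
      invFun := fun f => LinearMap.lsum Λ F ℕ (fun i => (f i : F i →ₗ[Λ] B))
      map_add' := fun _ _ => rfl
      map_smul' := fun _ _ => rfl
      left_inv := fun f => (LinearMap.lsum Λ F ℕ).apply_symm_apply (f : (∀ i, F i) →ₗ[Λ] B)
      right_inv := fun f => (LinearMap.lsum Λ F ℕ).symm_apply_apply
        (fun i => (f i : F i →ₗ[Λ] B)) }

theorem homLength_pi_right {κ : Type} [Fintype κ] (F : κ → Type u) [∀ i, AddCommGroup (F i)]
    [∀ i, Module Λ (F i)] :
    homLength k Λ A (∀ i, F i) = ∑ i, homLength k Λ A (F i) := by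
  unfold homLength
  rw [← Module.length_pi_of_fintype]
  exact LinearEquiv.length_eq (M := BaseHom Λ A (∀ i, F i)) (N := ∀ i, BaseHom Λ A (F i))
    { toFun := fun f i => LinearMap.proj i ∘ₗ (f : A →ₗ[Λ] ∀ i, F i)
      invFun := fun f => LinearMap.pi (fun i => (f i : A →ₗ[Λ] F i))
      map_add' := fun _ _ => rfl
      map_smul' := fun _ _ => rfl
      left_inv := fun _ => rfl
      right_inv := fun _ => rfl }

theorem homLength_eq_zero_iff : homLength k Λ A B = 0 ↔ ∀ f : A →ₗ[Λ] B, f = 0 := by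
  rw [homLength, Module.length_eq_zero_iff]
  exact ⟨fun h f => h.elim f 0, fun h => subsingleton_of_forall_eq 0 h⟩

/-- Evaluation at finitely many generators of `A` embeds `Hom(A, B)` in a power of `B`, which is
finitely generated over the artinian ring `k`. Finiteness is what permits cancellation in `ℕ∞`. -/
theorem homLength_ne_top [IsArtinianRing k] [Module.Finite k Λ] [Module.Finite Λ A]
    [Module.Finite Λ B] : homLength k Λ A B ≠ ⊤ := by
  let : Module k B := Module.compHom B (algebraMap k Λ)
  have : IsScalarTower k Λ B := IsScalarTower.of_algebraMap_smul fun _ _ => rfl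
  have : Module.Finite k B := Module.Finite.trans Λ B
  obtain ⟨n, f, hf⟩ := Module.Finite.exists_fin' Λ A
  let g : BaseHom Λ A B →ₗ[k] (Fin n → B) :=
    { toFun := fun φ i => (show A →ₗ[Λ] B from φ) (f (Pi.single i 1))
      map_add' := fun _ _ => rfl
      map_smul' := fun _ _ => rfl }
  have hg : Function.Injective g := by
    intro φ ψ h
    have : (φ : A →ₗ[Λ] B) ∘ₗ f = (ψ : A →ₗ[Λ] B) ∘ₗ f :=
      LinearMap.pi_ext' fun i => LinearMap.ext_ring (congrFun h i)
    refine LinearMap.ext fun x => ?_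
    obtain ⟨y, rfl⟩ := hf x
    exact LinearMap.congr_fun this y
  have : Module.Finite k (BaseHom Λ A B) := Module.Finite.of_injective g hg
  rw [homLength, Module.length_ne_top_iff, isFiniteLength_iff_isNoetherian_isArtinian]
  exact ⟨inferInstance, inferInstance⟩

theorem exists_simple_submodule {R M : Type u} [Ring R] [AddCommGroup M] [Module R M]
    [IsArtinian R M] [Nontrivial M] : ∃ S : Submodule R M, IsSimpleModule R S := by
  obtain ⟨S, hS, -⟩ := (eq_bot_or_exists_atom_le (⊤ : Submodule R M)).resolve_left top_ne_bot
  exact ⟨S, isSimpleModule_iff_isAtom.2 hS⟩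

theorem subtype_ne_zero {R M : Type u} [Ring R] [AddCommGroup M] [Module R M]
    (S : Submodule R M) [IsSimpleModule R S] : S.subtype ≠ 0 := fun h => by
  have := IsSimpleModule.nontrivial R S
  obtain ⟨x, hx⟩ := exists_ne (0 : S)
  exact hx (Subtype.ext (LinearMap.congr_fun h x))

variable [IsArtinianRing k] [Module.Finite k Λ] [IsArtinianRing Λ]

/-- A finitely generated injective module is determined by the lengths of `Hom(S, M)`
for simple modules `S`. -/
theorem nonempty_equiv_of_homLength_eq (M M' : ModuleCat.{u} Λ) [Module.Finite Λ M]
    [Module.Finite Λ M'] [Module.Injective Λ M] [Module.Injective Λ M']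
    (h : ∀ S : ModuleCat.{u} Λ, IsSimpleModule Λ S → homLength k Λ S M = homLength k Λ S M') :
    Nonempty (M ≃ₗ[Λ] M') := by
  induction hlen : Module.length Λ M using WellFoundedLT.induction generalizing M M' with
  | ind n ih =>
  subst hlen
  rcases subsingleton_or_nontrivial M with hs | hs
  · have hs' : Subsingleton M' := by
      by_contra hn
      rw [not_subsingleton_iff_nontrivial] at hn
      obtain ⟨S, hS⟩ := exists_simple_submodule (R := Λ) (M := M')
      have h0 : homLength k Λ S M' = 0 := by
        rw [← h (ModuleCat.of Λ S) hS, homLength_eq_zero_iff]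
        exact fun f => LinearMap.ext fun x => Subsingleton.elim _ _
      exact subtype_ne_zero S (homLength_eq_zero_iff.1 h0 _)
    exact ⟨⟨0, 0, fun x => Subsingleton.elim _ _, fun x => Subsingleton.elim _ _⟩⟩
  obtain ⟨n, N, hN, ⟨e⟩⟩ := exists_equiv_pi_isIndec M
  obtain ⟨i⟩ : Nonempty (Fin n) := by
    by_contra hempty
    rw [not_nonempty_iff] at hempty
    have := e.toEquiv.subsingleton
    exact not_subsingleton M this
  have hret : IsRetract Λ (N i) M :=
    (IsRetract.proj_comp (F := fun i => N i) (fun _ : Unit => i) (fun _ _ _ => rfl)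
      |> (IsRetract.of_equiv (LinearEquiv.funUnique Unit Λ (N i)).symm).trans).trans
      (IsRetract.of_equiv e.symm)
  have := hret.injective
  have := hret.finite
  have := (hN i).1
  -- A simple submodule `S` of the indecomposable summand `N i` also embeds in `M'` by the equality
  -- of lengths, so `N i` is a summand of `M'` too. Splitting it off both sides leaves shorter
  -- modules that still satisfy the hypothesis.
  obtain ⟨S, hS⟩ := exists_simple_submodule (R := Λ) (M := N i)
  obtain ⟨a, b, hab⟩ := id hret
  have hSM : homLength k Λ S M ≠ 0 := by
    intro h0
    rw [homLength_eq_zero_iff] at h0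
    refine subtype_ne_zero S (LinearMap.ext fun x => ?_)
    have h1 := LinearMap.congr_fun (h0 (a ∘ₗ S.subtype)) x
    have h2 := congrArg b h1
    simpa [hab] using h2
  rw [h (ModuleCat.of Λ S) hS, Ne, homLength_eq_zero_iff, not_forall] at hSM
  obtain ⟨f, hf⟩ := hSM
  have hret' : IsRetract Λ (N i) M' :=
    (hN i).isRetract_of_injective S.subtype (subtype_ne_zero S) f hf
  obtain ⟨L, hL, ⟨eL⟩⟩ := hret.exists_compl
  obtain ⟨L', hL', ⟨eL'⟩⟩ := hret'.exists_compl
  have := hL.injective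
  have := hL'.injective
  have := hL.finite
  have := hL'.finite
  obtain ⟨e'⟩ := ih (Module.length Λ L) (by
    rw [eL.length_eq, Module.length_prod, add_comm]
    have hfin : Module.length Λ L ≠ ⊤ := Module.length_ne_top_iff.2
      (isFiniteLength_iff_isNoetherian_isArtinian.2 ⟨inferInstance, inferInstance⟩)
    simpa using (ENat.add_lt_add_iff_left hfin).2 (Module.length_pos (R := Λ) (M := N i)))
    (ModuleCat.of Λ L) (ModuleCat.of Λ L') (by
      intro S hS
      have h1 := h S hS
      rw [homLength_congr_right eL, homLength_congr_right eL', homLength_prod_right,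
        homLength_prod_right] at h1
      exact ENat.add_right_injective_of_ne_top homLength_ne_top h1) rfl
  exact ⟨eL.trans (((LinearEquiv.refl Λ (N i)).prodCongr e').trans eL'.symm)⟩

end HomLength

/-! ### Schanuel's lemma for two-step resolutions -/

section Schanuel

variable {R : Type u} [Ring R]
variable {P A B C P' A' B' C' : Type u}
  [AddCommGroup P] [Module R P] [AddCommGroup A] [Module R A] [AddCommGroup B] [Module R B]
  [AddCommGroup C] [Module R C] [AddCommGroup P'] [Module R P'] [AddCommGroup A'] [Module R A']
  [AddCommGroup B'] [Module R B'] [AddCommGroup C'] [Module R C']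

/-- The kernel of `A × X → K × X` is `P` when `0 → P → A → B` is exact with `A → K` onto. -/
theorem nonempty_equiv_ker {X : Type u} [AddCommGroup X] [Module R X]
    (f : P →ₗ[R] A) (g : A →ₗ[R] B) (hf : Function.Injective f) (hfg : Function.Exact f g) :
    Nonempty (P ≃ₗ[R] LinearMap.ker (g.prodMap (LinearMap.id : X →ₗ[R] X))) := by
  let φ : P →ₗ[R] LinearMap.ker (g.prodMap (LinearMap.id : X →ₗ[R] X)) :=
    (LinearMap.inl R A X ∘ₗ f).codRestrict _ (fun x => by simp [hfg.apply_apply_eq_zero])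
  refine ⟨LinearEquiv.ofBijective φ ⟨fun x y h => hf ?_, ?_⟩⟩
  · exact congrArg (fun z => z.1.1) h
  · rintro ⟨⟨a, x⟩, h⟩
    have h1 : g a = 0 := congrArg Prod.fst h
    have h2 : x = 0 := congrArg Prod.snd h
    obtain ⟨p, rfl⟩ := (hfg a).1 h1
    subst h2
    exact ⟨p, rfl⟩

/-- Schanuel's lemma for exact sequences `0 → P → A → B → C → 0` and `0 → P' → A' → B' → C' → 0`
with projective middle terms whose ends become isomorphic after adding the middle terms. -/
theorem nonempty_equiv_of_exact
    [Module.Projective R A] [Module.Projective R B] [Module.Projective R A'] [Module.Projective R B']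
    (f : P →ₗ[R] A) (g : A →ₗ[R] B) (h : B →ₗ[R] C)
    (hf : Function.Injective f) (hfg : Function.Exact f g) (hgh : Function.Exact g h)
    (hh : Function.Surjective h)
    (f' : P' →ₗ[R] A') (g' : A' →ₗ[R] B') (h' : B' →ₗ[R] C')
    (hf' : Function.Injective f') (hfg' : Function.Exact f' g') (hgh' : Function.Exact g' h')
    (hh' : Function.Surjective h')
    (e : (A × (B' × C)) ≃ₗ[R] (A' × (B × C'))) :
    Nonempty ((P × (A' × (A × (B' × B)))) ≃ₗ[R] (P' × (A × (A' × (B × B'))))) := by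
  -- After the added summands, both right-hand maps are surjections from projectives onto the same
  -- module, with kernels the images of `g` and `g'`. The first application of Schanuel's lemma
  -- compares these images.
  let G : (A × (B' × B)) →ₗ[R] (A' × (B × C')) :=
    e.toLinearMap ∘ₗ LinearMap.prodMap LinearMap.id (LinearMap.prodMap LinearMap.id h)
  let G' : (A' × (B × B')) →ₗ[R] (A' × (B × C')) :=
    LinearMap.prodMap LinearMap.id (LinearMap.prodMap LinearMap.id h')
  have hG : Function.Surjective G :=
    e.surjective.comp (Function.surjective_id.prodMap (Function.surjective_id.prodMap hh))
  have hG' : Function.Surjective G' :=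
    Function.surjective_id.prodMap (Function.surjective_id.prodMap hh')
  obtain ⟨E⟩ := nonempty_ker_prod_equiv_of_projective G G' hG hG'
  let γ : A →ₗ[R] LinearMap.ker G :=
    (LinearMap.inr R A (B' × B) ∘ₗ LinearMap.inr R B' B ∘ₗ g).codRestrict _
      (fun x => by simp [G, hgh.apply_apply_eq_zero])
  let γ' : A' →ₗ[R] LinearMap.ker G' :=
    (LinearMap.inr R A' (B × B') ∘ₗ LinearMap.inr R B B' ∘ₗ g').codRestrict _
      (fun x => by simp [G', hgh'.apply_apply_eq_zero])
  have hγ : Function.Surjective γ := by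
    rintro ⟨⟨a, b', b⟩, hx⟩
    have hx' : (a, b', h b) = (0 : A × (B' × C)) := e.map_eq_zero_iff.1 hx
    simp only [Prod.mk_eq_zero] at hx'
    obtain ⟨rfl, rfl, hb⟩ := hx'
    obtain ⟨y, rfl⟩ := (hgh b).1 hb
    exact ⟨y, rfl⟩
  have hγ' : Function.Surjective γ' := by
    rintro ⟨⟨a, b', b⟩, hx⟩
    have hx' : (a, b', h' b) = (0 : A' × (B × C')) := hx
    simp only [Prod.mk_eq_zero] at hx'
    obtain ⟨rfl, rfl, hb⟩ := hx'
    obtain ⟨y, rfl⟩ := (hgh' b).1 hb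
    exact ⟨y, rfl⟩
  have hfγ : Function.Exact f γ := fun x => by
    rw [← hfg x]
    exact ⟨fun hx => congrArg (fun z => z.1.2.2) hx,
      fun hx => Subtype.ext (Prod.ext rfl (Prod.ext rfl hx))⟩
  have hfγ' : Function.Exact f' γ' := fun x => by
    rw [← hfg' x]
    exact ⟨fun hx => congrArg (fun z => z.1.2.2) hx,
      fun hx => Subtype.ext (Prod.ext rfl (Prod.ext rfl hx))⟩
  -- `E` gives `D` and `D'` a common target. Their kernels are copies of `P` and `P'`, and
  -- Schanuel's lemma applies a second time.
  let D := E.toLinearMap ∘ₗ γ.prodMap (LinearMap.id : (A' × (B × B')) →ₗ[R] _)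
  let D' := γ'.prodMap (LinearMap.id : (A × (B' × B)) →ₗ[R] _)
  obtain ⟨F⟩ := nonempty_ker_prod_equiv_of_projective D D'
    (E.surjective.comp (hγ.prodMap Function.surjective_id)) (hγ'.prodMap Function.surjective_id)
  obtain ⟨K⟩ := nonempty_equiv_ker (X := A' × (B × B')) f γ hf hfγ
  obtain ⟨K'⟩ := nonempty_equiv_ker (X := A × (B' × B)) f' γ' hf' hfγ'
  have hD : LinearMap.ker D = LinearMap.ker (γ.prodMap (LinearMap.id : (A' × (B × B')) →ₗ[R] _)) :=
    LinearEquiv.ker_comp _ _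
  exact ⟨((K.trans (LinearEquiv.ofEq _ _ hD.symm)).prodCongr (LinearEquiv.refl _ _)).trans
    (F.trans (K'.symm.prodCongr (LinearEquiv.refl _ _)))⟩

end Schanuel

/-! ### The counting argument -/

section Counting

variable {k : Type u} [CommRing k] {Λ : Type u} [Ring Λ] [Algebra k Λ]

/-- The direct sum of `n i` copies of `F i` for all `i`. -/
abbrev Copies {ι : Type} (n : ι → ℕ) (F : ι → ModuleCat.{u} Λ) : Type u :=
  ∀ x : Σ i, Fin (n i), F x.1

theorem projective_pi {R : Type u} [Ring R] {κ : Type} [Finite κ] (F : κ → Type u)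
    [∀ i, AddCommGroup (F i)] [∀ i, Module R (F i)] [∀ i, Module.Projective R (F i)] :
    Module.Projective R (∀ i, F i) := by
  classical
  cases nonempty_fintype κ
  exact Module.Projective.of_equiv (DirectSum.linearEquivFunOnFintype R κ F)

instance {ι : Type} [Finite ι] (n : ι → ℕ) (F : ι → ModuleCat.{u} Λ)
    [∀ i, Module.Projective Λ (F i)] : Module.Projective Λ (Copies n F) :=
  projective_pi _

/-- The componentwise map on direct sums of copies. -/
def copiesMap {ι : Type} (n : ι → ℕ) {F G : ι → ModuleCat.{u} Λ} (f : ∀ i, F i →ₗ[Λ] G i) :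
    Copies n F →ₗ[Λ] Copies n G :=
  LinearMap.pi fun x => f x.1 ∘ₗ LinearMap.proj x

theorem copiesMap_injective {ι : Type} (n : ι → ℕ) {F G : ι → ModuleCat.{u} Λ}
    (f : ∀ i, F i →ₗ[Λ] G i) (hf : ∀ i, Function.Injective (f i)) :
    Function.Injective (copiesMap n f) := fun _ _ h =>
  funext fun i => hf i.1 (congrFun h i)

theorem copiesMap_surjective {ι : Type} (n : ι → ℕ) {F G : ι → ModuleCat.{u} Λ}
    (f : ∀ i, F i →ₗ[Λ] G i) (hf : ∀ i, Function.Surjective (f i)) :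
    Function.Surjective (copiesMap n f) := fun y =>
  ⟨fun i => (hf i.1 (y i)).choose, funext fun i => (hf i.1 (y i)).choose_spec⟩

theorem copiesMap_exact {ι : Type} (n : ι → ℕ) {F G H : ι → ModuleCat.{u} Λ}
    (f : ∀ i, F i →ₗ[Λ] G i) (g : ∀ i, G i →ₗ[Λ] H i) (h : ∀ i, Function.Exact (f i) (g i)) :
    Function.Exact (copiesMap n f) (copiesMap n g) := fun y => by
  constructor
  · intro hy
    have hy' : ∀ i, ∃ x, f i.1 x = y i := fun i => (h i.1 (y i)).1 (congrFun hy i)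
    choose x hx using hy'
    exact ⟨x, funext hx⟩
  · rintro ⟨x, rfl⟩
    exact funext fun i => (h i.1).apply_apply_eq_zero (x i)

theorem homLength_copies_right {ι : Type} [Fintype ι] (n : ι → ℕ) (F : ι → ModuleCat.{u} Λ)
    (A : Type u) [AddCommGroup A] [Module Λ A] :
    homLength k Λ A (Copies n F) = ∑ i, n i * homLength k Λ A (F i) := by
  rw [homLength_pi_right, Fintype.sum_sigma]
  refine Finset.sum_congr rfl fun i _ => ?_
  change ∑ _ : Fin (n i), homLength k Λ A (F i) = _
  simp

theorem homLength_copies_left {ι : Type} [Fintype ι] (n : ι → ℕ) (F : ι → ModuleCat.{u} Λ)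
    (A : Type u) [AddCommGroup A] [Module Λ A] :
    homLength k Λ (Copies n F) A = ∑ i, n i * homLength k Λ (F i) A := by
  rw [homLength_pi_left, Fintype.sum_sigma]
  refine Finset.sum_congr rfl fun i _ => ?_
  change ∑ _ : Fin (n i), homLength k Λ (F i) A = _
  simp

/-- The equation with index `i₀` is void, so there are fewer equations than unknowns. -/
theorem exists_ne_zero_sum_eq_zero {ι : Type} [Fintype ι] [DecidableEq ι] (i₀ : ι)
    (c : ι → ι → ℤ) (hc : ∀ j, c i₀ j = 0) : ∃ a : ι → ℤ, a ≠ 0 ∧ ∀ i, ∑ j, a j * c i j = 0 := by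
  let φ : (ι → ℤ) →ₗ[ℤ] ({i // i ≠ i₀} → ℤ) :=
    LinearMap.pi fun i => ∑ j, c i j • LinearMap.proj j
  have hφ : ¬ Function.Injective φ := fun h => by
    have h1 := card_le_of_injective ℤ φ h
    have h2 : Fintype.card {i // i ≠ i₀} < Fintype.card ι :=
      Fintype.card_subtype_lt (x := i₀) (by simp)
    omega
  rw [← LinearMap.ker_eq_bot] at hφ
  obtain ⟨a, ha, ha0⟩ := Submodule.exists_mem_ne_zero_of_ne_bot hφ
  refine ⟨a, ha0, fun i => ?_⟩
  by_cases hi : i = i₀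
  · subst hi
    simp [hc]
  · have := congrFun (LinearMap.mem_ker.1 ha) ⟨i, hi⟩
    simpa [φ, mul_comm] using this

variable [IsArtinianRing k] [Module.Finite k Λ] [IsArtinianRing Λ]

/-- The `P j` are dual to the simples `S i` under Hom, so as many resolutions as simples are
available. The absence of `S i₀` from all the injective terms produces an integral relation among
the resolutions, which would descend to a relation among the `P j`. -/
theorem false_of_resolutions {ι : Type} [Fintype ι] (S P A B C : ι → ModuleCat.{u} Λ) (i₀ : ι)
    (hS : ∀ i, IsSimpleModule Λ (S i))
    (hSall : ∀ S' : ModuleCat.{u} Λ, IsSimpleModule Λ S' → ∃ i, Nonempty (S' ≃ₗ[Λ] S i))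
    (hPS : ∀ i j, homLength k Λ (P j) (S i) = 0 ↔ i ≠ j)
    [∀ j, Module.Finite Λ (P j)] [∀ j, Module.Finite Λ (A j)] [∀ j, Module.Finite Λ (B j)]
    [∀ j, Module.Finite Λ (C j)]
    [∀ j, Module.Projective Λ (A j)] [∀ j, Module.Projective Λ (B j)]
    [∀ j, Module.Injective Λ (A j)] [∀ j, Module.Injective Λ (B j)]
    [∀ j, Module.Injective Λ (C j)]
    (f : ∀ j, P j →ₗ[Λ] A j) (g : ∀ j, A j →ₗ[Λ] B j) (h : ∀ j, B j →ₗ[Λ] C j)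
    (hf : ∀ j, Function.Injective (f j)) (hfg : ∀ j, Function.Exact (f j) (g j))
    (hgh : ∀ j, Function.Exact (g j) (h j)) (hh : ∀ j, Function.Surjective (h j))
    (hA : ∀ j, homLength k Λ (S i₀) (A j) = 0) (hB : ∀ j, homLength k Λ (S i₀) (B j) = 0)
    (hC : ∀ j, homLength k Λ (S i₀) (C j) = 0) : False := by
  classical
  have hSfin : ∀ i, Module.Finite Λ (S i) := fun i => inferInstance
  let s (i : ι) (F : ι → ModuleCat.{u} Λ) (j : ι) : ℕ := (homLength k Λ (S i) (F j)).toNat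
  let t (i : ι) (F : ι → ModuleCat.{u} Λ) (j : ι) : ℕ := (homLength k Λ (F j) (S i)).toNat
  have hs : ∀ (i : ι) (F : ι → ModuleCat.{u} Λ) (_ : ∀ j, Module.Finite Λ (F j)) (n : ι → ℕ),
      homLength k Λ (S i) (Copies n F) = ((∑ j, n j * s i F j : ℕ) : ℕ∞) := by
    intro i F hF n
    rw [homLength_copies_right]
    push_cast
    exact Finset.sum_congr rfl fun j _ => by rw [ENat.natCast_toNat homLength_ne_top]
  have ht : ∀ (i : ι) (F : ι → ModuleCat.{u} Λ) (_ : ∀ j, Module.Finite Λ (F j)) (n : ι → ℕ),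
      homLength k Λ (Copies n F) (S i) = ((∑ j, n j * t i F j : ℕ) : ℕ∞) := by
    intro i F hF n
    rw [homLength_copies_left]
    push_cast
    exact Finset.sum_congr rfl fun j _ => by rw [ENat.natCast_toNat homLength_ne_top]
  obtain ⟨a, ha0, ha⟩ := exists_ne_zero_sum_eq_zero i₀
    (fun i j => (s i A j : ℤ) - s i B j + s i C j) (fun j => by simp [s, hA, hB, hC])
  -- Positive and negative parts of `a`, used as multiplicities on the two sides of an isomorphism.
  let b (j : ι) : ℕ := (a j).toNat
  let c (j : ι) : ℕ := (-a j).toNat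
  have habc : ∀ j, a j = b j - c j := fun j => by simp only [b, c]; omega
  obtain ⟨e⟩ := nonempty_equiv_of_homLength_eq (k := k)
    (ModuleCat.of Λ (Copies b A × (Copies c B × Copies b C)))
    (ModuleCat.of Λ (Copies c A × (Copies b B × Copies c C))) (by
      intro S' hS'
      obtain ⟨i, ⟨ei⟩⟩ := hSall S' hS'
      rw [homLength_congr_left ei, homLength_congr_left ei]
      simp only [homLength_prod_right, hs _ _ inferInstance]
      norm_cast
      zify
      have := ha i
      simp only [habc, mul_add, mul_sub, sub_mul, Finset.sum_add_distrib,
        Finset.sum_sub_distrib] at this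
      linarith)
  obtain ⟨E⟩ := nonempty_equiv_of_exact (copiesMap b f) (copiesMap b g) (copiesMap b h)
    (copiesMap_injective b f hf) (copiesMap_exact b f g hfg) (copiesMap_exact b g h hgh)
    (copiesMap_surjective b h hh) (copiesMap c f) (copiesMap c g) (copiesMap c h)
    (copiesMap_injective c f hf) (copiesMap_exact c f g hfg) (copiesMap_exact c g h hgh)
    (copiesMap_surjective c h hh) e
  refine ha0 (funext fun i => ?_)
  -- The middle terms occur on both sides with finite length and cancel. Only `P i` has nonzero maps
  -- to `S i`, so `b i = c i`.
  have h1 := homLength_congr_left (k := k) (B := S i) E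
  simp only [homLength_prod_left, ht _ _ inferInstance] at h1
  norm_cast at h1
  have h2 : ∑ j, b j * t i P j = ∑ j, c j * t i P j := by omega
  have h3 : ∀ n : ι → ℕ, ∑ j, n j * t i P j = n i * t i P i := fun n => by
    refine Finset.sum_eq_single i (fun j _ hj => ?_) (by simp)
    simp [t, (hPS i j).2 hj.symm]
  have h4 : t i P i ≠ 0 := fun h0 => by
    have h5 : homLength k Λ (P i) (S i) ≠ 0 := fun h6 => (hPS i i).1 h6 rfl
    rcases ENat.toNat_eq_zero.1 h0 with h6 | h6
    · exact h5 h6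
    · exact homLength_ne_top h6
  rw [h3, h3] at h2
  have h5 := Nat.eq_of_mul_eq_mul_right (Nat.pos_of_ne_zero h4) h2
  rw [habc, h5, sub_self]
  rfl

end Counting

/-! ### Dimension shifting -/

section Dimension

variable {R : Type u} [Ring R] {A B C : Type u} [AddCommGroup A] [Module R A]
  [AddCommGroup B] [Module R B] [AddCommGroup C] [Module R C]

theorem exists_shortExact (f : A →ₗ[R] B) (g : B →ₗ[R] C) (hf : Function.Injective f)
    (hfg : Function.Exact f g) (hg : Function.Surjective g) :
    (ModuleCat.shortComplexOfCompEqZero f g hfg.linearMap_comp_eq_zero).ShortExact :=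
  ModuleCat.shortComplex_shortExact _ hfg hf hg

theorem hasInjectiveDimensionLT_of_exact {n : ℕ} (f : A →ₗ[R] B) (g : B →ₗ[R] C)
    (hf : Function.Injective f) (hfg : Function.Exact f g) (hg : Function.Surjective g)
    [Module.Injective R B] (h : HasInjectiveDimensionLT (ModuleCat.of R A) (n + 2)) :
    HasInjectiveDimensionLT (ModuleCat.of R C) (n + 1) :=
  ((exists_shortExact f g hf hfg hg).hasInjectiveDimensionLT_X₃_iff n
    (Module.injective_object_of_injective_module R B)).2 h

theorem IsRetract.retract (h : IsRetract R A B) :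
    Nonempty (Retract (ModuleCat.of R A) (ModuleCat.of R B)) := by
  obtain ⟨i, r, hr⟩ := h
  exact ⟨⟨ModuleCat.ofHom i, ModuleCat.ofHom r, by ext x; exact hr x⟩⟩

theorem injective_of_hasInjectiveDimensionLT_one (h : HasInjectiveDimensionLT (ModuleCat.of R A) 1) :
    Module.Injective R A := by
  have : Injective (ModuleCat.of R A) := inferInstance
  exact Module.injective_module_of_injective_object R A

end Dimension

/-! ### Resolutions of the summands of the ring -/

section Resolution

variable {R : Type u} [Ring R] {P I₀ I₁ S : Type u} [AddCommGroup P] [Module R P]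
  [AddCommGroup I₀] [Module R I₀] [AddCommGroup I₁] [Module R I₁] [AddCommGroup S] [Module R S]
  [Module.Injective R I₀] [Module.Injective R I₁]

/-- The sequence `0 → R → I₀ → I₁` yields `0 → P → I₀ → I₀ × I₁` for every summand `P` of `R`. -/
theorem exists_resolution_of_isRetract (i₀ : R →ₗ[R] I₀) (d : I₀ →ₗ[R] I₁)
    (hi : Function.Injective i₀) (hd : Function.Exact i₀ d) (hP : IsRetract R P R)
    (hdim : HasInjectiveDimensionLT (ModuleCat.of R R) 3) :
    ∃ (f : P →ₗ[R] I₀) (g : I₀ →ₗ[R] I₀ × I₁), Function.Injective f ∧ Function.Exact f g ∧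
      Module.Injective R ((I₀ × I₁) ⧸ LinearMap.range g) ∧
      ((∀ φ : S →ₗ[R] I₀, φ = 0) → (∀ φ : S →ₗ[R] I₁, φ = 0) →
        (∀ φ : S →ₗ[R] I₁ ⧸ LinearMap.range d, φ = 0) →
        ∀ φ : S →ₗ[R] (I₀ × I₁) ⧸ LinearMap.range g, φ = 0) := by
  obtain ⟨ρ⟩ := hP.retract
  obtain ⟨i, r, hr⟩ := hP
  -- With `ε = i ∘ r` the idempotent projecting `R` onto `P`, the maps `h` and `h'` extend `1 - ε`
  -- and `ε` to `I₀`. Adding the component `h` to `d` cuts the kernel `R` of `d` down to `P`.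
  obtain ⟨h, hh⟩ := Module.Injective.out i₀ hi (i₀ ∘ₗ (LinearMap.id - i ∘ₗ r))
  obtain ⟨h', hh'⟩ := Module.Injective.out i₀ hi (i₀ ∘ₗ i ∘ₗ r)
  have hf : Function.Injective (i₀ ∘ₗ i) := hi.comp (Function.LeftInverse.injective hr)
  have hfg : Function.Exact (i₀ ∘ₗ i) (h.prod d) := fun x => by
    constructor
    · intro hx
      obtain ⟨l, rfl⟩ := (hd x).1 (congrArg Prod.snd hx)
      have h1 : h (i₀ l) = 0 := congrArg Prod.fst hx
      rw [hh] at h1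
      have h2 : l - i (r l) = 0 := hi (by simpa using h1)
      exact ⟨r l, by simp [← sub_eq_zero.1 h2]⟩
    · rintro ⟨p, rfl⟩
      simp [hh, hr, hd.apply_apply_eq_zero]
  refine ⟨i₀ ∘ₗ i, h.prod d, hf, hfg, ?_, fun h0 h1 h2 φ => ?_⟩
  · have d1 : HasInjectiveDimensionLT (ModuleCat.of R (LinearMap.range (h.prod d))) 2 := by
      refine hasInjectiveDimensionLT_of_exact (i₀ ∘ₗ i) (h.prod d).rangeRestrict hf (fun x => ?_)
        (h.prod d).surjective_rangeRestrict (ρ.hasInjectiveDimensionLT 3)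
      rw [← hfg x]
      exact ⟨fun hx => congrArg Subtype.val hx, fun hx => Subtype.ext hx⟩
    exact injective_of_hasInjectiveDimensionLT_one (hasInjectiveDimensionLT_of_exact
      (LinearMap.range (h.prod d)).subtype (LinearMap.range (h.prod d)).mkQ
      (Submodule.subtype_injective _) (LinearMap.exact_subtype_mkQ _)
      (Submodule.mkQ_surjective _) d1)
  -- The cokernel of `(h, d)` modulo the image of `ψ` is `I₁ / im d`, so `φ` lands in `range ψ`.
  -- Moreover `ker ψ = h (ker d)` is the copy of `(1 - ε) R` in `I₀`, which is also the kernel of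
  -- `(h', d)`; hence `range ψ` embeds in `I₀ × I₁`.
  · let ψ : I₀ →ₗ[R] (I₀ × I₁) ⧸ LinearMap.range (h.prod d) :=
      (LinearMap.range (h.prod d)).mkQ ∘ₗ LinearMap.inl R I₀ I₁
    let κ : ((I₀ × I₁) ⧸ LinearMap.range (h.prod d)) →ₗ[R] I₁ ⧸ LinearMap.range d :=
      (LinearMap.range (h.prod d)).liftQ ((LinearMap.range d).mkQ ∘ₗ LinearMap.snd R I₀ I₁) (by
        rintro _ ⟨x, rfl⟩
        simp)
    have hφ : ∀ s, φ s ∈ LinearMap.range ψ := by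
      intro s
      have hκ : κ (φ s) = 0 := LinearMap.congr_fun (h2 (κ ∘ₗ φ)) s
      obtain ⟨⟨a, b⟩, hab⟩ := Submodule.Quotient.mk_surjective _ (φ s)
      rw [← hab] at hκ ⊢
      have hb : b ∈ LinearMap.range d := (Submodule.Quotient.mk_eq_zero _).1 hκ
      obtain ⟨y, rfl⟩ := hb
      refine ⟨a - h y, ?_⟩
      simp only [ψ, LinearMap.comp_apply, Submodule.mkQ_apply, LinearMap.inl_apply]
      rw [Submodule.Quotient.eq]
      exact ⟨-y, by simp⟩
    have hker : LinearMap.ker ψ = LinearMap.ker (h'.prod d) := by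
      ext a
      have hψ : a ∈ LinearMap.ker ψ ↔ ∃ y, h y = a ∧ d y = 0 := by
        refine (Submodule.Quotient.mk_eq_zero _).trans ⟨?_, ?_⟩
        · rintro ⟨y, hy⟩
          exact ⟨y, congrArg Prod.fst hy, congrArg Prod.snd hy⟩
        · rintro ⟨y, h1, h2⟩
          exact ⟨y, Prod.ext h1 h2⟩
      have hk : a ∈ LinearMap.ker (h'.prod d) ↔ h' a = 0 ∧ d a = 0 := by
        rw [LinearMap.mem_ker, LinearMap.prod_apply]
        exact Prod.mk_eq_zero
      rw [hψ, hk]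
      constructor
      · rintro ⟨y, rfl, hy⟩
        obtain ⟨l, rfl⟩ := (hd y).1 hy
        rw [hh]
        simp [hh', hr, hd.apply_apply_eq_zero]
      · rintro ⟨ha, hda⟩
        obtain ⟨l, rfl⟩ := (hd a).1 hda
        rw [hh'] at ha
        refine ⟨i₀ l, ?_, hd.apply_apply_eq_zero l⟩
        rw [hh]
        have : i₀ (i (r l)) = 0 := ha
        simp [this]
    let τ : LinearMap.range ψ →ₗ[R] I₀ × I₁ :=
      (LinearMap.ker ψ).liftQ (h'.prod d) hker.le ∘ₗ ψ.quotKerEquivRange.symm.toLinearMap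
    have hτ : Function.Injective τ := by
      have h5 : Function.Injective ((LinearMap.ker ψ).liftQ (h'.prod d) hker.le) := by
        rw [← LinearMap.ker_eq_bot]
        exact Submodule.ker_liftQ_eq_bot' _ _ hker
      exact h5.comp ψ.quotKerEquivRange.symm.injective
    have h3 : τ ∘ₗ φ.codRestrict _ hφ = 0 := by
      have e1 := h0 (LinearMap.fst R I₀ I₁ ∘ₗ τ ∘ₗ φ.codRestrict _ hφ)
      have e2 := h1 (LinearMap.snd R I₀ I₁ ∘ₗ τ ∘ₗ φ.codRestrict _ hφ)
      exact LinearMap.ext fun s => Prod.ext (LinearMap.congr_fun e1 s) (LinearMap.congr_fun e2 s)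
    refine LinearMap.ext fun s => ?_
    have h4 : φ.codRestrict _ hφ s = 0 := hτ (by simpa using LinearMap.congr_fun h3 s)
    exact congrArg Subtype.val h4

end Resolution

/-! ### Every simple module occurs in the resolution -/

section Cogenerator

variable (k : Type u) [CommRing k] {Λ : Type u} [Ring Λ] [Algebra k Λ]

/-- If `0 → Λ → I₀ → I₁` is the start of an injective resolution with projective terms and `Λ` has
injective dimension at most two, then `I₀ × I₁ × coker (I₀ → I₁)` contains every simple module. -/
theorem exists_ne_zero_of_resolution [IsArtinianRing k] [Module.Finite k Λ] [IsArtinianRing Λ]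
    (I₀ I₁ : ModuleCat.{u} Λ)
    [Module.Finite Λ I₀] [Module.Finite Λ I₁] [Module.Projective Λ I₀] [Module.Projective Λ I₁]
    [Module.Injective Λ I₀] [Module.Injective Λ I₁]
    (i₀ : Λ →ₗ[Λ] I₀) (d : I₀ →ₗ[Λ] I₁) (hi : Function.Injective i₀) (hd : Function.Exact i₀ d)
    (hdim : HasInjectiveDimensionLT (ModuleCat.of Λ Λ) 3)
    (S : ModuleCat.{u} Λ) (hS : IsSimpleModule Λ S) :
    (∃ φ : S →ₗ[Λ] I₀, φ ≠ 0) ∨ (∃ φ : S →ₗ[Λ] I₁, φ ≠ 0) ∨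
      ∃ φ : S →ₗ[Λ] I₁ ⧸ LinearMap.range d, φ ≠ 0 := by
  by_contra! hcon
  obtain ⟨h0, h1, h2⟩ := hcon
  obtain ⟨n, N, hN, ⟨e⟩⟩ := exists_equiv_pi_isIndec (ModuleCat.of Λ Λ)
  have hret : ∀ i, IsRetract Λ (N i) Λ := fun i =>
    (IsRetract.proj_comp (F := fun i => N i) (fun _ : Unit => i) (fun _ _ _ => rfl)
      |> (IsRetract.of_equiv (LinearEquiv.funUnique Unit Λ (N i)).symm).trans).trans
      (IsRetract.of_equiv e.symm)
  have hfin : ∀ i, Module.Finite Λ (N i) := fun i => (hret i).finite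
  have hproj : ∀ i, Module.Projective Λ (N i) := fun i => (hret i).projective
  have hmax : ∀ i, ∃ m : Submodule Λ (N i), IsCoatom m := fun i => by
    have := (hN i).1
    obtain ⟨m, hm, -⟩ := (eq_top_or_exists_le_coatom (⊥ : Submodule Λ (N i))).resolve_left bot_ne_top
    exact ⟨m, hm⟩
  choose m hm using hmax
  let T (i : Fin n) : ModuleCat.{u} Λ := ModuleCat.of Λ (N i ⧸ m i)
  have hT : ∀ i, IsSimpleModule Λ (T i) := fun i => isSimpleModule_iff_isCoatom.2 (hm i)
  let q (i : Fin n) : N i →ₗ[Λ] T i := (m i).mkQ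
  have hq : ∀ i, q i ≠ 0 := fun i h => by
    have := IsSimpleModule.nontrivial Λ (T i)
    obtain ⟨x, hx⟩ := exists_ne (0 : T i)
    obtain ⟨y, rfl⟩ := (m i).mkQ_surjective x
    exact hx (LinearMap.congr_fun h y)
  -- One index per isomorphism class of tops. Every simple module is a quotient of some `N i`, so
  -- these tops exhaust the simples.
  obtain ⟨t, ε, -, hε, hε'⟩ := exists_representatives T (fun _ => True)
  have hall : ∀ S' : ModuleCat.{u} Λ, IsSimpleModule Λ S' → ∃ j, Nonempty (S' ≃ₗ[Λ] T (ε j)) := by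
    intro S' hS'
    have := IsSimpleModule.nontrivial Λ S'
    obtain ⟨x, hx⟩ := exists_ne (0 : S')
    let φ : (∀ i, N i) →ₗ[Λ] S' := LinearMap.toSpanSingleton Λ S' x ∘ₗ e.symm.toLinearMap
    obtain ⟨i, hφi⟩ : ∃ i, φ ∘ₗ LinearMap.single Λ (fun i => N i) i ≠ 0 := by
      by_contra! hz
      have hφ0 : φ = 0 := LinearMap.pi_ext' fun i => by simpa using hz i
      have := LinearMap.congr_fun hφ0 (e (1 : Λ))
      simp [φ] at this
      exact hx this
    obtain ⟨u⟩ := (hN i).nonempty_equiv_of_projective _ hφi (q i) (hq i)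
    obtain ⟨j, ⟨v⟩⟩ := hε' i trivial
    exact ⟨j, ⟨u.trans v.toLinearEquiv⟩⟩
  obtain ⟨j₀, ⟨e₀⟩⟩ := hall S hS
  choose f g hf hfg hinj hzero using fun j : Fin t =>
    exists_resolution_of_isRetract (S := S) i₀ d hi hd (hret (ε j)) hdim
  refine false_of_resolutions (k := k) (fun j => T (ε j)) (fun j => N (ε j)) (fun _ => I₀)
    (fun _ => ModuleCat.of Λ (I₀ × I₁))
    (fun j => ModuleCat.of Λ ((I₀ × I₁) ⧸ LinearMap.range (g j))) j₀ (fun j => hT _) hall ?_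
    f g (fun j => (LinearMap.range (g j)).mkQ) hf hfg (fun j => LinearMap.exact_map_mkQ_range _)
    (fun j => Submodule.mkQ_surjective _) ?_ ?_ ?_
  · intro i j
    rw [homLength_eq_zero_iff]
    constructor
    · rintro h rfl
      exact hq _ (h _)
    · intro hij φ
      by_contra hφ
      obtain ⟨u⟩ := (hN (ε j)).nonempty_equiv_of_projective φ hφ (q (ε j)) (hq (ε j))
      exact hij (hε i j ⟨u.toModuleIso⟩)
  all_goals
    intro j
    rw [← homLength_congr_left e₀, homLength_eq_zero_iff]
  · exact h0
  · intro φ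
    exact LinearMap.ext fun s => Prod.ext
      (LinearMap.congr_fun (h0 (LinearMap.fst Λ I₀ I₁ ∘ₗ φ)) s)
      (LinearMap.congr_fun (h1 (LinearMap.snd Λ I₀ I₁ ∘ₗ φ)) s)
  · exact hzero j h0 h1 h2

end Cogenerator

/-! ### Additive closures -/

section Add

variable {R : Type u} [Ring R]

/-- `M` is a direct summand of a finite power of `X`. -/
def InAdd (R X M : Type u) [Ring R] [AddCommGroup X] [Module R X] [AddCommGroup M]
    [Module R M] : Prop :=
  ∃ m : ℕ, IsRetract R M (Fin m → X)

variable {X Y M N : Type u} [AddCommGroup X] [Module R X] [AddCommGroup Y] [Module R Y]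
  [AddCommGroup M] [Module R M] [AddCommGroup N] [Module R N]

theorem isInAdd_iff (X M : ModuleCat.{u} R) : IsInAdd X M ↔ InAdd R X M := by
  constructor
  · rintro ⟨m, ⟨ρ⟩⟩
    exact ⟨m, ρ.i.hom, ρ.r.hom, fun x => LinearMap.congr_fun (congrArg ModuleCat.Hom.hom ρ.retract) x⟩
  · rintro ⟨m, h⟩
    exact ⟨m, h.retract⟩

theorem InAdd.of_retract (h : InAdd R X N) (h' : IsRetract R M N) : InAdd R X M := by
  obtain ⟨m, hm⟩ := h
  exact ⟨m, h'.trans hm⟩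

theorem inAdd_of_fintype {κ : Type} [Fintype κ] (h : IsRetract R M (κ → X)) : InAdd R X M :=
  ⟨Fintype.card κ, h.trans (IsRetract.of_equiv (LinearEquiv.funCongrLeft R X (Fintype.equivFin κ).symm))⟩

theorem IsRetract.inAdd (h : IsRetract R M X) : InAdd R X M :=
  inAdd_of_fintype (κ := Unit) (h.trans (IsRetract.of_equiv (LinearEquiv.funUnique Unit R X).symm))

theorem InAdd.pi {κ : Type} [Finite κ] {F : κ → Type u} [∀ i, AddCommGroup (F i)]
    [∀ i, Module R (F i)] (h : ∀ i, InAdd R X (F i)) : InAdd R X (∀ i, F i) := by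
  cases nonempty_fintype κ
  choose m hm using h
  exact inAdd_of_fintype ((IsRetract.pi hm).trans
    (IsRetract.of_equiv (LinearEquiv.piCurry R (fun (i : κ) (_ : Fin (m i)) => X)).symm))

theorem InAdd.prod (h : InAdd R X M) (h' : InAdd R X N) : InAdd R X (M × N) := by
  obtain ⟨m, hm⟩ := h
  obtain ⟨n, hn⟩ := h'
  exact inAdd_of_fintype ((hm.prod hn).trans
    (IsRetract.of_equiv (LinearEquiv.sumArrowLequivProdArrow (Fin m) (Fin n) R X).symm))

theorem InAdd.trans (h : InAdd R Y X) (h' : InAdd R X M) : InAdd R Y M := by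
  obtain ⟨m, hm⟩ := h'
  exact (InAdd.pi fun _ : Fin m => h).of_retract hm

/-- If the maps `X → W` separate the points of an artinian module `X`, then `X` embeds into a
finite power of `W`. -/
theorem exists_injective_pow {W : Type u} [AddCommGroup W] [Module R W] [IsArtinian R X]
    (h : ∀ x : X, x ≠ 0 → ∃ f : X →ₗ[R] W, f x ≠ 0) :
    ∃ (m : ℕ) (f : X →ₗ[R] (Fin m → W)), Function.Injective f := by
  -- A minimal kernel of a map to a finite power is zero: adjoining a map that separates a nonzero
  -- element would shrink it.
  obtain ⟨K, ⟨m, f, rfl⟩, hmin⟩ := IsArtinian.set_has_minimal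
    {K : Submodule R X | ∃ (m : ℕ) (f : X →ₗ[R] (Fin m → W)), K = LinearMap.ker f}
    ⟨_, 0, 0, rfl⟩
  refine ⟨m, f, ?_⟩
  rw [← LinearMap.ker_eq_bot]
  by_contra hne
  obtain ⟨x, hx, hx0⟩ := Submodule.exists_mem_ne_zero_of_ne_bot hne
  obtain ⟨g, hg⟩ := h x hx0
  let φ : X →ₗ[R] (Fin (m + 1) → W) := LinearMap.pi (Fin.cons g fun i => LinearMap.proj i ∘ₗ f)
  have hle : LinearMap.ker φ ≤ LinearMap.ker f := fun y hy =>
    LinearMap.mem_ker.2 (funext fun i => by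
      have h1 : φ y = 0 := hy
      simpa [φ] using congrFun h1 i.succ)
  refine hmin _ ⟨m + 1, φ, rfl⟩ (lt_of_le_of_ne hle fun heq => hg ?_)
  have h1 : φ x = 0 := LinearMap.mem_ker.1 (heq ▸ hx)
  simpa [φ] using congrFun h1 0

end Add

/-! ### The duality over the base ring -/

section BaseRing

variable {k : Type u} [CommRing k]

theorem isTorsionBySet_quotient_jacobson :
    Module.IsTorsionBySet k (k ⧸ Ring.jacobson k) (Ring.jacobson k) := by
  rintro x ⟨a, ha⟩
  obtain ⟨y, rfl⟩ := Submodule.Quotient.mk_surjective _ x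
  rw [← Submodule.Quotient.mk_smul, Submodule.Quotient.mk_eq_zero]
  exact Ideal.mul_mem_right _ _ ha

theorem injective_coextendScalars {Λ : Type u} [Ring Λ] [Algebra k Λ]
    (J : ModuleCat.{u} k) [Module.Injective k J] :
    Module.Injective Λ ((ModuleCat.coextendScalars (algebraMap k Λ)).obj J) := by
  have : Injective J := Module.injective_object_of_injective_module k J
  have : Injective ((ModuleCat.coextendScalars (algebraMap k Λ)).obj J) :=
    Injective.injective_of_adjoint (ModuleCat.restrictCoextendScalarsAdj (algebraMap k Λ)) J
  exact Module.injective_module_of_injective_object Λ _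

variable [IsArtinianRing k]

theorem isSemisimpleModule_of_isTorsionBySet {M : Type u} [AddCommGroup M] [Module k M]
    (h : Module.IsTorsionBySet k M (Ring.jacobson k)) : IsSemisimpleModule k M := by
  let _ := h.module
  exact (h.semilinearMap.isSemisimpleModule_iff_of_bijective Function.bijective_id).2 inferInstance

variable {J : Type u} [AddCommGroup J] [Module k J]

/-- Multiplication by finitely many generators of `I` maps `J[I^(n+1)]` to a finite power of
`J[I^n]`, with kernel inside `J[I]`. -/
theorem isNoetherian_torsionBySet_succ (I : Ideal k) (n : ℕ)
    (h1 : IsNoetherian k (Submodule.torsionBySet k J I))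
    (hn : IsNoetherian k (Submodule.torsionBySet k J (I ^ n : Ideal k))) :
    IsNoetherian k (Submodule.torsionBySet k J (I ^ (n + 1) : Ideal k)) := by
  obtain ⟨s, hs⟩ := IsNoetherian.noetherian I
  let E : Submodule k J := Submodule.torsionBySet k J (I ^ (n + 1) : Ideal k)
  have hmem : ∀ (r : s) (x : E), (r : k) • (x : J) ∈
      Submodule.torsionBySet k J (I ^ n : Ideal k) := by
    rintro ⟨r, hr⟩ ⟨x, hx⟩
    rw [Submodule.mem_torsionBySet_iff] at hx ⊢
    rintro ⟨a, ha⟩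
    have hrI : r ∈ I := hs ▸ Submodule.subset_span hr
    have h2 : (a * r) • x = 0 := hx ⟨a * r, by rw [pow_succ]; exact Ideal.mul_mem_mul ha hrI⟩
    rwa [mul_smul] at h2
  let φ : E →ₗ[k] (s → Submodule.torsionBySet k J (I ^ n : Ideal k)) := LinearMap.pi fun r =>
    ((r : k) • E.subtype).codRestrict _ (hmem r)
  have hker : ∀ x ∈ LinearMap.ker φ, (x : J) ∈ Submodule.torsionBySet k J (I : Set k) := by
    intro x hx
    rw [Submodule.mem_torsionBySet_iff]
    have hsub : I ≤ LinearMap.ker (LinearMap.toSpanSingleton k J (x : J)) := by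
      rw [← hs, Submodule.span_le]
      intro r hr
      have h2 : φ x = 0 := hx
      exact congrArg Subtype.val (congrFun h2 ⟨r, hr⟩)
    rintro ⟨a, ha⟩
    exact hsub ha
  let ψ : LinearMap.ker φ →ₗ[k] Submodule.torsionBySet k J (I : Set k) :=
    (E.subtype ∘ₗ (LinearMap.ker φ).subtype).codRestrict _ (fun x => hker x x.2)
  have hψ : Function.Injective ψ := fun x y h => by
    have h' : ((x : E) : J) = y :=
      congrArg (fun z : Submodule.torsionBySet k J (I : Set k) => (z : J)) h
    exact Subtype.ext (Subtype.ext h')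
  have : IsNoetherian k (LinearMap.ker φ) := isNoetherian_of_injective ψ hψ
  exact isNoetherian_of_range_eq_ker (LinearMap.ker φ).subtype φ (by simp)

/-- The part of `J` killed by the radical is semisimple, so it has no proper essential submodule. -/
theorem torsionBySet_jacobson_le_range (f : (k ⧸ Ring.jacobson k) →ₗ[k] J)
    (hess : IsEssential (LinearMap.range f)) :
    Submodule.torsionBySet k J (Ring.jacobson k) ≤ LinearMap.range f := by
  let E : Submodule k J := Submodule.torsionBySet k J (Ring.jacobson k)
  have htors : Module.IsTorsionBySet k E (Ring.jacobson k) := Submodule.torsionBySet_isTorsionBySet _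
  have := isSemisimpleModule_of_isTorsionBySet htors
  obtain ⟨L, hL⟩ := exists_isCompl ((LinearMap.range f).comap E.subtype)
  have hL0 : L = ⊥ := by
    have h1 : L.map E.subtype = ⊥ := by
      refine hess _ (eq_bot_iff.2 ?_)
      rintro _ ⟨hx, ⟨y, hy, rfl⟩⟩
      have : y ∈ (LinearMap.range f).comap E.subtype ⊓ L := ⟨hx, hy⟩
      rw [hL.inf_eq_bot, Submodule.mem_bot] at this
      simp [this]
    refine eq_bot_iff.2 fun x hx => ?_
    have h2 : (x : J) ∈ L.map E.subtype := ⟨x, hx, rfl⟩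
    rw [h1, Submodule.mem_bot] at h2
    exact Subtype.ext h2
  have htop := hL.sup_eq_top
  rw [hL0, sup_bot_eq] at htop
  intro x hx
  exact (htop ▸ Submodule.mem_top : (⟨x, hx⟩ : E) ∈ (LinearMap.range f).comap E.subtype)

/-- The injective envelope of `k / rad k` has finite length. -/
theorem finite_of_isInjectiveEnvelope
    (h : IsInjectiveEnvelope (R := k) (k ⧸ Ring.jacobson k) J) : Module.Finite k J := by
  obtain ⟨-, f, -, hess⟩ := h
  -- As the radical is nilpotent, `J` is exhausted by the torsion submodules of its powers, each
  -- Noetherian by induction.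
  obtain ⟨n, hn⟩ : IsNilpotent (Ring.jacobson k) := IsSemiprimaryRing.isNilpotent
  have hN1 : IsNoetherian k (Submodule.torsionBySet k J (Ring.jacobson k)) :=
    isNoetherian_of_le (torsionBySet_jacobson_le_range f hess)
  have hN : ∀ n, IsNoetherian k (Submodule.torsionBySet k J (Ring.jacobson k ^ n : Ideal k)) := by
    intro n
    induction n with
    | zero =>
      have : Submodule.torsionBySet k J (Ring.jacobson k ^ 0 : Ideal k) = ⊥ := by
        refine eq_bot_iff.2 fun x hx => ?_
        rw [Submodule.mem_torsionBySet_iff] at hx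
        have h1 : (1 : k) • x = 0 := hx ⟨1, by rw [pow_zero, Ideal.one_eq_top]; trivial⟩
        rwa [one_smul] at h1
      rw [this]
      infer_instance
    | succ n ih => exact isNoetherian_torsionBySet_succ _ n hN1 ih
  have htop : Submodule.torsionBySet k J (Ring.jacobson k ^ n : Ideal k) = ⊤ := by
    refine eq_top_iff.2 fun x _ => ?_
    rw [Submodule.mem_torsionBySet_iff, hn]
    rintro ⟨a, ha⟩
    rw [SetLike.mem_coe, Ideal.zero_eq_bot, Ideal.mem_bot] at ha
    rw [Subtype.coe_mk, ha, zero_smul]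
  have := hN n
  rw [htop] at this
  exact Module.Finite.equiv (Submodule.topEquiv (R := k) (M := J))

/-- The injective envelope of `k / rad k` is a cogenerator. -/
theorem exists_ne_zero_of_isInjectiveEnvelope
    (h : IsInjectiveEnvelope (R := k) (k ⧸ Ring.jacobson k) J)
    {Y : Type u} [AddCommGroup Y] [Module k Y] (y : Y) (hy : y ≠ 0) :
    ∃ φ : Y →ₗ[k] J, φ y ≠ 0 := by
  obtain ⟨hJ, f, hf, -⟩ := h
  let Z := Submodule.span k {y}
  have hyZ : y ∈ Z := Submodule.mem_span_singleton_self y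
  have : Nontrivial Z := ⟨⟨y, hyZ⟩, 0, fun h => hy (congrArg Subtype.val h)⟩
  -- The cyclic module `Z` has a simple quotient in which `y` survives. That quotient is an image of
  -- the semisimple module `k / rad k`, hence embeds in it and so in `J`; injectivity extends the
  -- map to `Y`.
  obtain ⟨m, hm, -⟩ := (eq_top_or_exists_le_coatom (⊥ : Submodule k Z)).resolve_left bot_ne_top
  have hS : IsSimpleModule k (Z ⧸ m) := isSimpleModule_iff_isCoatom.2 hm
  let s : Z ⧸ m := m.mkQ ⟨y, hyZ⟩
  have hs : s ≠ 0 := by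
    intro h0
    have hmem : (⟨y, hyZ⟩ : Z) ∈ m := (Submodule.Quotient.mk_eq_zero _).1 h0
    refine hm.1 (eq_top_iff.2 ?_)
    rintro ⟨z, hz⟩ -
    obtain ⟨a, rfl⟩ := Submodule.mem_span_singleton.1 hz
    exact m.smul_mem a hmem
  let π : (k ⧸ Ring.jacobson k) →ₗ[k] Z ⧸ m :=
    (Ring.jacobson k).liftQ (LinearMap.toSpanSingleton k (Z ⧸ m) s) (fun a ha => by
      have := IsSemisimpleModule.jacobson_le_annihilator k (Z ⧸ m) ha
      exact Module.mem_annihilator.1 this s)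
  have hπ : Function.Surjective π := by
    refine LinearMap.surjective_of_ne_zero fun h0 => hs ?_
    have : (1 : k) • s = 0 := LinearMap.congr_fun h0 (Submodule.Quotient.mk 1)
    rwa [one_smul] at this
  have := isSemisimpleModule_of_isTorsionBySet (isTorsionBySet_quotient_jacobson (k := k))
  obtain ⟨σ, hσ⟩ := IsSemisimpleModule.lifting_property π hπ LinearMap.id
  obtain ⟨φ, hφ⟩ := Module.Injective.out Z.subtype Z.subtype_injective (f ∘ₗ σ ∘ₗ m.mkQ)
  refine ⟨φ, fun h0 => hs ?_⟩
  have h1 : f (σ s) = 0 := by rw [← h0]; exact (hφ ⟨y, hyZ⟩).symm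
  have h2 : σ s = 0 := hf (by rw [h1, map_zero])
  rw [← LinearMap.id_apply (R := k) s, ← hσ, LinearMap.comp_apply, h2, map_zero]

theorem exists_ne_zero_moduleCat {J : ModuleCat.{u} k}
    (h : IsInjectiveEnvelope (R := k) (k ⧸ Ring.jacobson k) J) (Y : ModuleCat.{u} k)
    (y : Y) (hy : y ≠ 0) : ∃ φ : Y ⟶ J, φ.hom y ≠ 0 := by
  obtain ⟨φ, hφ⟩ := exists_ne_zero_of_isInjectiveEnvelope h y hy
  exact ⟨ModuleCat.ofHom φ, hφ⟩

variable {Λ : Type u} [Ring Λ] [Algebra k Λ]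

/-- A `k`-linear map `Λ → J` is determined by its values at finitely many generators of `Λ`, so `DΛ`
embeds `k`-linearly in a power of `J`. -/
theorem finite_coextendScalars [Module.Finite k Λ] (J : ModuleCat.{u} k) [Module.Finite k J] :
    Module.Finite Λ ((ModuleCat.coextendScalars (algebraMap k Λ)).obj J) := by
  let D := (ModuleCat.coextendScalars (algebraMap k Λ)).obj J
  let _ : Module k D := Module.compHom D (algebraMap k Λ)
  have : IsScalarTower k Λ D := IsScalarTower.of_algebraMap_smul fun _ _ => rfl
  obtain ⟨n, f, hf⟩ := Module.Finite.exists_fin' k Λ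
  let g : D →ₗ[k] (Fin n → J) :=
    { toFun := fun φ i => φ (f (Pi.single i 1))
      map_add' := fun _ _ => rfl
      map_smul' := fun r φ => funext fun i => by
        change φ (f (Pi.single i 1) * algebraMap k Λ r) = r • φ (f (Pi.single i 1))
        rw [← Algebra.commutes]
        exact (ModuleCat.CoextendScalars.equiv (algebraMap k Λ) J φ).map_smul r _ }
  have hg : Function.Injective g := by
    intro φ ψ h
    refine ModuleCat.CoextendScalars.ext (LinearMap.ext fun x => ?_)
    obtain ⟨y, rfl⟩ := hf x
    let F (φ : D) : (Fin n → k) →ₗ[k] J :=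
      { toFun := fun y => φ (f y)
        map_add' := fun y z => by
          rw [map_add]
          exact (ModuleCat.CoextendScalars.equiv (algebraMap k Λ) J φ).map_add _ _
        map_smul' := fun r y => by
          rw [map_smul, Algebra.smul_def]
          exact (ModuleCat.CoextendScalars.equiv (algebraMap k Λ) J φ).map_smul r _ }
    have hF : F φ = F ψ := LinearMap.pi_ext' fun i => LinearMap.ext_ring (congrFun h i)
    exact LinearMap.congr_fun hF y
  have : Module.Finite k D := Module.Finite.of_injective g hg
  exact Module.Finite.of_restrictScalars_finite k Λ D

/-- By adjunction, a `k`-linear `φ : X → J` corresponds to a `Λ`-linear map `X → DΛ` whose value at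
`x`, evaluated at `1`, is `φ x`. -/
theorem exists_ne_zero_coextendScalars {J : ModuleCat.{u} k}
    (h : IsInjectiveEnvelope (R := k) (k ⧸ Ring.jacobson k) J) (X : ModuleCat.{u} Λ)
    (x : X) (hx : x ≠ 0) :
    ∃ φ : X →ₗ[Λ] (ModuleCat.coextendScalars (algebraMap k Λ)).obj J, φ x ≠ 0 := by
  obtain ⟨φ, hφ⟩ := exists_ne_zero_moduleCat h
    ((ModuleCat.restrictScalars (algebraMap k Λ)).obj X) x hx
  refine ⟨(ModuleCat.RestrictionCoextensionAdj.HomEquiv.fromRestriction (algebraMap k Λ)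
    φ).hom, fun h0 => hφ ?_⟩
  have := ModuleCat.RestrictionCoextensionAdj.HomEquiv.fromRestriction_hom_apply_apply
    (algebraMap k Λ) φ x 1
  rw [h0, one_smul] at this
  exact this.symm

end BaseRing

/-! ### Minimal injective resolutions -/

section MinimalResolution

variable {R : Type u} [Ring R]

/-- A chosen injective envelope of `M`. -/
noncomputable def envelope (M : ModuleCat.{u} R) : ModuleCat.{u} R :=
  (exists_isInjectiveEnvelope M).choose

theorem isInjectiveEnvelope_envelope (M : ModuleCat.{u} R) :
    IsInjectiveEnvelope (R := R) M (envelope M) :=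
  (exists_isInjectiveEnvelope M).choose_spec

/-- The inclusion of `M` into its injective envelope. -/
noncomputable def envelopeι (M : ModuleCat.{u} R) : M →ₗ[R] envelope M :=
  (isInjectiveEnvelope_envelope M).2.choose

theorem envelopeι_injective (M : ModuleCat.{u} R) : Function.Injective (envelopeι M) :=
  (isInjectiveEnvelope_envelope M).2.choose_spec.1

theorem envelopeι_essential (M : ModuleCat.{u} R) : IsEssential (LinearMap.range (envelopeι M)) :=
  (isInjectiveEnvelope_envelope M).2.choose_spec.2

/-- The cosyzygies of `M`. -/
noncomputable def cosyzygy (M : ModuleCat.{u} R) : ℕ → ModuleCat.{u} R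
  | 0 => M
  | n + 1 => ModuleCat.of R (envelope (cosyzygy M n) ⧸ LinearMap.range (envelopeι (cosyzygy M n)))

/-- The differential of the minimal injective resolution of `M`. -/
noncomputable def minimalD (M : ModuleCat.{u} R) (n : ℕ) :
    envelope (cosyzygy M n) ⟶ envelope (cosyzygy M (n + 1)) :=
  ModuleCat.ofHom (envelopeι (cosyzygy M (n + 1)) ∘ₗ
    (LinearMap.range (envelopeι (cosyzygy M n))).mkQ)

theorem ker_minimalD (M : ModuleCat.{u} R) (n : ℕ) :
    LinearMap.ker (minimalD M n).hom = LinearMap.range (envelopeι (cosyzygy M n)) := by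
  ext x
  refine Iff.trans ?_ (Submodule.Quotient.mk_eq_zero (LinearMap.range (envelopeι (cosyzygy M n))))
  exact map_eq_zero_iff (envelopeι (cosyzygy M (n + 1))) (envelopeι_injective _)

theorem range_minimalD (M : ModuleCat.{u} R) (n : ℕ) :
    LinearMap.range (minimalD M n).hom = LinearMap.range (envelopeι (cosyzygy M (n + 1))) :=
  LinearMap.range_comp_of_range_eq_top _ (Submodule.range_mkQ _)

theorem exact_minimalD (M : ModuleCat.{u} R) (n : ℕ) :
    Function.Exact (minimalD M n).hom (minimalD M (n + 1)).hom := by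
  rw [LinearMap.exact_iff, ker_minimalD, range_minimalD]

/-- The cochain complex underlying the minimal injective resolution of `M`. -/
noncomputable def minimalComplex (M : ModuleCat.{u} R) : CochainComplex (ModuleCat.{u} R) ℕ :=
  CochainComplex.of (fun n => envelope (cosyzygy M n)) (minimalD M) (fun n => by
    ext x
    exact (exact_minimalD M n).apply_apply_eq_zero x)

theorem minimalComplex_d (M : ModuleCat.{u} R) (n : ℕ) :
    (minimalComplex M).d n (n + 1) = minimalD M n :=
  CochainComplex.of_d (fun n => envelope (cosyzygy M n)) (minimalD M) n

theorem envelopeι_comp_minimalD (M : ModuleCat.{u} R) :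
    (ModuleCat.ofHom (envelopeι M) : M ⟶ (minimalComplex M).X 0) ≫ (minimalComplex M).d 0 1 = 0 := by
  rw [minimalComplex_d]
  ext x
  have h : envelopeι M x ∈ LinearMap.ker (minimalD M 0).hom := by
    rw [ker_minimalD]
    exact ⟨x, rfl⟩
  exact h

/-- The augmentation of the minimal injective resolution of `M`. -/
noncomputable def minimalι (M : ModuleCat.{u} R) :
    (CochainComplex.single₀ (ModuleCat.{u} R)).obj M ⟶ minimalComplex M :=
  (CochainComplex.fromSingle₀Equiv _ _).symm ⟨ModuleCat.ofHom (envelopeι M),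
    envelopeι_comp_minimalD M⟩

theorem minimalι_f_zero (M : ModuleCat.{u} R) :
    (minimalι M).f 0 = (ModuleCat.ofHom (envelopeι M) : M ⟶ (minimalComplex M).X 0) :=
  CochainComplex.fromSingle₀Equiv_symm_apply_f_zero _ _

theorem minimalComplex_exactAt_succ (M : ModuleCat.{u} R) (n : ℕ) :
    (minimalComplex M).ExactAt (n + 1) := by
  rw [HomologicalComplex.exactAt_iff' _ n (n + 1) (n + 2) (by simp) (by simp)]
  rw [ShortComplex.ShortExact.moduleCat_exact_iff_function_exact]
  change Function.Exact ((minimalComplex M).d n (n + 1)).hom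
    ((minimalComplex M).d (n + 1) (n + 1 + 1)).hom
  rw [minimalComplex_d, minimalComplex_d]
  exact exact_minimalD M n

theorem exact_augmentation (M : ModuleCat.{u} R) :
    (ShortComplex.mk _ _ (envelopeι_comp_minimalD M)).Exact ∧
      Mono (ModuleCat.ofHom (envelopeι M) : M ⟶ (minimalComplex M).X 0) := by
  refine ⟨?_, (ModuleCat.mono_iff_injective _).2 (envelopeι_injective M)⟩
  rw [ShortComplex.ShortExact.moduleCat_exact_iff_function_exact]
  change Function.Exact (envelopeι M) ((minimalComplex M).d 0 1).hom
  rw [minimalComplex_d]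
  exact LinearMap.exact_iff.2 (ker_minimalD M 0)

theorem quasiIso_minimalι (M : ModuleCat.{u} R) : QuasiIso (minimalι M) := by
  refine ⟨fun n => ?_⟩
  cases n with
  | zero =>
    rw [CochainComplex.quasiIsoAt₀_iff, ShortComplex.quasiIso_iff_of_zeros]
    · refine (ShortComplex.exact_and_mono_f_iff_of_iso ?_).2 (exact_augmentation M)
      refine ShortComplex.isoMk (Iso.refl _) (Iso.refl _) (Iso.refl _) ?_ ?_
      · exact (Category.id_comp _).trans (minimalι_f_zero M).symm
      · exact (Category.id_comp _).trans (Category.comp_id _).symm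
    all_goals rfl
  | succ n =>
    rw [quasiIsoAt_iff_exactAt]
    · exact minimalComplex_exactAt_succ M n
    · exact CochainComplex.exactAt_succ_single_obj _ _

/-- A minimal injective resolution of `M`. -/
noncomputable def minimalResolution (M : ModuleCat.{u} R) : InjectiveResolution M where
  cocomplex := minimalComplex M
  injective n :=
    have := (isInjectiveEnvelope_envelope (cosyzygy M n)).1
    Module.injective_object_of_injective_module R (envelope (cosyzygy M n))
  ι := minimalι M
  quasiIso := quasiIso_minimalι M

theorem isMinimalResolution_minimalResolution (M : ModuleCat.{u} R) :
    IsMinimalResolution (minimalResolution M) := fun n => by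
  have h : (minimalResolution M).cocomplex.d n (n + 1) = minimalD M n := minimalComplex_d M n
  rw [h]
  have h' := envelopeι_essential (cosyzygy M n)
  rw [← ker_minimalD] at h'
  exact h'

end MinimalResolution

/-! ### Dominant dimension at least two -/

section DominantDimension

variable {R : Type u} [Ring R]

/-- The supremum is at least two only if some admissible length exceeds one. -/
theorem two_le_domDim_iff (M : ModuleCat.{u} R) :
    2 ≤ domDim M ↔ ∃ I : InjectiveResolution M, IsMinimalResolution I ∧
      Projective (I.cocomplex.X 0) ∧ Projective (I.cocomplex.X 1) := by
  constructor
  · intro h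
    by_contra hcon
    have h1 : domDim M ≤ 1 := by
      refine sSup_le ?_
      rintro _ ⟨k, rfl, I, hI, hk⟩
      by_contra hlt
      have hk2 : 1 < k := by exact_mod_cast not_le.1 hlt
      exact hcon ⟨I, hI, hk 0 (by omega), hk 1 hk2⟩
    have h2 := h.trans h1
    norm_num at h2
  · rintro ⟨I, hI, h0, h1⟩
    refine le_sSup ⟨2, rfl, I, hI, fun i hi => ?_⟩
    interval_cases i
    · exact h0
    · exact h1

theorem isInjectiveEnvelope_zero {M : ModuleCat.{u} R} (I : InjectiveResolution M)
    (hI : IsMinimalResolution I) :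
    ∃ i : M →ₗ[R] I.cocomplex.X 0, Function.Injective i ∧
      Function.Exact i (I.cocomplex.d 0 1).hom ∧ IsEssential (LinearMap.range i) := by
  let f : M ⟶ I.cocomplex.X 0 := I.ι.f 0
  have h1 : Function.Injective f.hom :=
    (ModuleCat.mono_iff_injective f).1 (inferInstanceAs (Mono (I.ι.f 0)))
  have h2 : Function.Exact f.hom (I.cocomplex.d 0 1).hom := by
    have := (ShortComplex.ShortExact.moduleCat_exact_iff_function_exact _).1
      (ShortComplex.exact_of_f_is_kernel (ShortComplex.mk _ _ I.ι_f_zero_comp_complex_d)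
        I.isLimitKernelFork)
    exact this
  refine ⟨f.hom, h1, h2, ?_⟩
  rw [← LinearMap.exact_iff.1 h2]
  exact hI 0

theorem resolution_exact {M : ModuleCat.{u} R} (I : InjectiveResolution M) (n : ℕ) :
    Function.Exact (I.cocomplex.d n (n + 1)).hom (I.cocomplex.d (n + 1) (n + 2)).hom :=
  (ShortComplex.ShortExact.moduleCat_exact_iff_function_exact _).1 (I.exact_succ n)

instance resolution_injective {M : ModuleCat.{u} R} (I : InjectiveResolution M) (n : ℕ) :
    Module.Injective R (I.cocomplex.X n) :=
  have := I.injective n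
  Module.injective_module_of_injective_object R (I.cocomplex.X n)

theorem exists_injective_of_ker_eq {A B C : Type u} [AddCommGroup A] [Module R A]
    [AddCommGroup B] [Module R B] [AddCommGroup C] [Module R C] (f : A →ₗ[R] B) (g : A →ₗ[R] C)
    (h : LinearMap.ker f = LinearMap.ker g) :
    ∃ w : LinearMap.range f →ₗ[R] C, Function.Injective w := by
  have h1 : Function.Injective ((LinearMap.ker f).liftQ g h.le) := by
    rw [← LinearMap.ker_eq_bot]
    exact Submodule.ker_liftQ_eq_bot' _ _ h
  exact ⟨(LinearMap.ker f).liftQ g h.le ∘ₗ f.quotKerEquivRange.symm.toLinearMap,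
    h1.comp f.quotKerEquivRange.symm.injective⟩

theorem projective_of_isRetract {M : ModuleCat.{u} R} {X : Type u} [AddCommGroup X] [Module R X]
    [Module.Projective R X] (h : IsRetract R M X) : Projective M :=
  (IsProjective.iff_projective M).1 h.projective

/-- If `M` embeds into a projective-injective module whose quotient by `M` also embeds into a
projective-injective module, then the dominant dimension of `M` is at least two. -/
theorem two_le_domDim (M : ModuleCat.{u} R) {X Y : Type u} [AddCommGroup X] [Module R X]
    [AddCommGroup Y] [Module R Y] [Module.Projective R X] [Module.Injective R X]
    [Module.Projective R Y] [Module.Injective R Y] (j : M →ₗ[R] X) (hj : Function.Injective j)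
    (l : (X ⧸ LinearMap.range j) →ₗ[R] Y) (hl : Function.Injective l) : 2 ≤ domDim M := by
  let I := minimalResolution M
  have hI : IsMinimalResolution I := isMinimalResolution_minimalResolution M
  refine (two_le_domDim_iff M).2 ⟨I, hI, ?_, ?_⟩
  all_goals
    obtain ⟨i, hi, hexact, hess⟩ := isInjectiveEnvelope_zero I hI
    obtain ⟨v, hv⟩ := Module.Injective.out i hi j
    have hvinj : Function.Injective v := injective_of_essential hess v (by
      rwa [show v ∘ₗ i = j from LinearMap.ext hv])
  · exact projective_of_isRetract (isRetract_of_injective v hvinj)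
  · let d := (I.cocomplex.d 0 1).hom
    -- Since `v` is injective and extends `j`, the kernel of `I⁰ → X → X/M` is exactly `M`. So the
    -- image of `d` embeds in `X/M`, hence in `Y`, and its envelope `I¹` is a summand of `Y`.
    have hker : LinearMap.ker ((LinearMap.range j).mkQ ∘ₗ v) = LinearMap.ker d := by
      rw [LinearMap.exact_iff.1 hexact]
      ext x
      simp only [LinearMap.mem_ker, LinearMap.comp_apply, Submodule.mkQ_apply,
        Submodule.Quotient.mk_eq_zero, LinearMap.mem_range]
      exact ⟨fun ⟨y, hy⟩ => ⟨y, hvinj (by rw [hv, hy])⟩, fun ⟨y, hy⟩ => ⟨y, by rw [← hv, hy]⟩⟩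
    obtain ⟨w, hw⟩ := exists_injective_of_ker_eq d (l ∘ₗ (LinearMap.range j).mkQ ∘ₗ v) (by
      rw [← hker]
      exact (LinearMap.ker_comp_of_ker_eq_bot _ (LinearMap.ker_eq_bot.2 hl)).symm)
    have henv : IsInjectiveEnvelope (R := R) (LinearMap.range d) (I.cocomplex.X 1) := by
      refine ⟨inferInstance, (LinearMap.range d).subtype, Submodule.subtype_injective _, ?_⟩
      rw [Submodule.range_subtype, ← LinearMap.exact_iff.1 (resolution_exact I 0)]
      exact hI 1
    exact projective_of_isRetract (henv.isRetract w hw)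

end DominantDimension

/-! ### Injective dimension on additive closures -/

section InjectiveDimension

variable {R : Type u} [Ring R]

theorem hasInjectiveDimensionLT_of_inAdd {T M : Type u} [AddCommGroup T] [Module R T]
    [AddCommGroup M] [Module R M] (hT : HasInjectiveDimensionLT (ModuleCat.of R T) 2)
    (h : InAdd R T M) : HasInjectiveDimensionLT (ModuleCat.of R M) 2 := by
  obtain ⟨E, hE, i, hi, -⟩ := exists_isInjectiveEnvelope (ModuleCat.of R T)
  have hq : Module.Injective R (E ⧸ LinearMap.range i) :=
    injective_of_hasInjectiveDimensionLT_one (hasInjectiveDimensionLT_of_exact i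
      (LinearMap.range i).mkQ hi (LinearMap.exact_map_mkQ_range i) (Submodule.mkQ_surjective _) hT)
  obtain ⟨m, hm⟩ := h
  obtain ⟨ρ⟩ := hm.retract
  let f : (Fin m → T) →ₗ[R] (Fin m → E) := LinearMap.pi fun a => i ∘ₗ LinearMap.proj a
  let g : (Fin m → E) →ₗ[R] (Fin m → (E ⧸ LinearMap.range i)) :=
    LinearMap.pi fun a => (LinearMap.range i).mkQ ∘ₗ LinearMap.proj a
  have hf : Function.Injective f := fun x y h => funext fun a => hi (congrFun h a)
  have hg : Function.Surjective g := fun y =>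
    ⟨fun a => ((LinearMap.range i).mkQ_surjective (y a)).choose,
      funext fun a => ((LinearMap.range i).mkQ_surjective (y a)).choose_spec⟩
  have hfg : Function.Exact f g := fun y => by
    constructor
    · intro hy
      have hy' : ∀ a, ∃ x, i x = y a := fun a =>
        (LinearMap.exact_map_mkQ_range i (y a)).1 (congrFun hy a)
      choose x hx using hy'
      exact ⟨x, funext hx⟩
    · rintro ⟨x, rfl⟩
      exact funext fun a => (LinearMap.exact_map_mkQ_range i).apply_apply_eq_zero (x a)
  have hC : Injective (ModuleCat.of R (Fin m → (E ⧸ LinearMap.range i))) :=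
    Module.injective_object_of_injective_module R _
  have hB : Injective (ModuleCat.of R (Fin m → E)) :=
    Module.injective_object_of_injective_module R _
  have : HasInjectiveDimensionLT (ModuleCat.of R (Fin m → T)) 2 :=
    ((exists_shortExact f g hf hfg hg).hasInjectiveDimensionLT_X₃_iff 0 hB).1
      (inferInstanceAs (HasInjectiveDimensionLT
        (ModuleCat.of R (Fin m → (E ⧸ LinearMap.range i))) 1))
  exact ρ.hasInjectiveDimensionLT 2

end InjectiveDimension

/-! ### From a tilting-cotilting module to the Auslander–Gorenstein property -/

section Backward

variable {k : Type u} [CommRing k] {Λ : Type u} [Ring Λ] [Algebra k Λ]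

theorem IsSumOfProjInj.module {Q : ModuleCat.{u} Λ} (hQ : IsSumOfProjInj Q) :
    Module.Finite Λ Q ∧ Module.Projective Λ Q ∧ Module.Injective Λ Q := by
  obtain ⟨t, P, hP, -, -, ⟨e⟩⟩ := hQ
  have h1 : ∀ i, Module.Finite Λ (P i) := fun i => (hP i).1
  have h2 : ∀ i, Module.Projective Λ (P i) := fun i =>
    (IsProjective.iff_projective (P i)).2 (hP i).2.2.1
  have h3 : ∀ i, Module.Injective Λ (P i) := fun i =>
    have := (hP i).2.2.2
    Module.injective_module_of_injective_object Λ (P i)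
  have h4 : Module.Projective Λ (∀ i, P i) := projective_pi _
  have hr : IsRetract Λ Q (∀ i, P i) := IsRetract.of_equiv e.toLinearEquiv
  exact ⟨hr.finite, hr.projective, hr.injective⟩

theorem isAuslanderGorenstein_of_exists [IsArtinianRing k] [IsArtinianRing Λ]
    {T : ModuleCat.{u} Λ} (hC : IsInC T) (hT : IsTilting T) (hcT : IsCotilting k T) : IsAuslanderGorenstein Λ 1 := by
  obtain ⟨-, Q, hQ, ⟨m, p, hp⟩, ⟨n, q, hq⟩⟩ := hC
  obtain ⟨hQfin, hQproj, hQinj⟩ := hQ.module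
  have hTid : HasInjectiveDimensionLT T 2 := (injectiveDimension_le_iff T 1).1
    hcT.injectiveDimension_le
  obtain ⟨T₀, T₁, i, π, hT₀, hT₁, hi, hiπ, hπ⟩ := hT.exists_coresolution
  rw [isInAdd_iff] at hT₀ hT₁
  constructor
  · refine (injectiveDimension_le_iff _ 2).2 ?_
    have hT₀' := hasInjectiveDimensionLT_of_inAdd hTid hT₀
    exact (exists_shortExact i π hi hiπ hπ).hasInjectiveDimensionLT_X₁ 2
      (hasInjectiveDimensionLT_of_inAdd hTid hT₁)
      (hasInjectiveDimensionLT_of_ge (ModuleCat.of Λ T₀) 2 3 (by norm_num))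
  obtain ⟨a, s₀, r₀, hr₀⟩ := hT₀
  let X := Fin a → Fin n → Q
  let j : Λ →ₗ[Λ] X := LinearMap.pi (fun b => q ∘ₗ LinearMap.proj b) ∘ₗ s₀ ∘ₗ i
  have hj : Function.Injective j := by
    refine Function.Injective.comp (g := LinearMap.pi (fun b => q ∘ₗ LinearMap.proj b)) ?_
      ((Function.LeftInverse.injective hr₀).comp hi)
    exact fun x y h => funext fun b => hq (congrFun h b)
  have hX1 : Module.Projective Λ (Fin n → Q) := projective_pi _
  have hX : Module.Projective Λ X := projective_pi _
  obtain ⟨J, hJ, C₀, C₁, f, g, hC₀, hC₁, hf, hfg, hg⟩ := hcT.exists_resolution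
  rw [isInAdd_iff] at hC₀ hC₁
  obtain ⟨b, s₁, r₁, hr₁⟩ := hC₀
  let Y := Fin b → Fin m → Q
  let c : Y →ₗ[Λ] C₀ := r₁ ∘ₗ LinearMap.pi (fun b => p ∘ₗ LinearMap.proj b)
  have hc : Function.Surjective c := by
    refine Function.Surjective.comp (g := r₁) (fun x => ⟨s₁ x, hr₁ x⟩) (fun y => ?_)
    exact ⟨fun b => (hp (y b)).choose, funext fun b => (hp (y b)).choose_spec⟩
  -- `α` lifts `φ` from the projective module `X`, but need not vanish on `Λ`. Its value at `j 1`
  -- lies in the image of `C₀`, hence comes from some `y ∈ Y`; as `Y` is injective, `1 ↦ y` extends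
  -- to `β : X → Y`, and subtracting `f ∘ c ∘ β` makes the lift descend to `X/Λ` without changing it
  -- modulo `C₀`.
  have hlift : ∀ φ : (X ⧸ LinearMap.range j) →ₗ[Λ]
      (ModuleCat.coextendScalars (algebraMap k Λ)).obj J,
      ∃ φ' : (X ⧸ LinearMap.range j) →ₗ[Λ] C₁, g ∘ₗ φ' = φ := by
    intro φ
    obtain ⟨α, hα⟩ := Module.projective_lifting_property g (φ ∘ₗ (LinearMap.range j).mkQ) hg
    have h0 : g (α (j 1)) = 0 := by
      have h1 : g (α (j 1)) = φ ((LinearMap.range j).mkQ (j 1)) := LinearMap.congr_fun hα (j 1)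
      rw [h1, Submodule.mkQ_apply, (Submodule.Quotient.mk_eq_zero _).2 (LinearMap.mem_range_self j 1), map_zero]
    obtain ⟨x, hx⟩ := (hfg _).1 h0
    obtain ⟨y, rfl⟩ := hc x
    obtain ⟨β, hβ⟩ := Module.Injective.out j hj (LinearMap.toSpanSingleton Λ Y y)
    refine ⟨(LinearMap.range j).liftQ (α - f ∘ₗ c ∘ₗ β) ?_, ?_⟩
    · rintro _ ⟨l, rfl⟩
      have h1 : j l = l • j 1 := by rw [← map_smul, smul_eq_mul, mul_one]
      have h2 : β (j 1) = y := by simp [hβ]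
      rw [h1, LinearMap.mem_ker, map_smul]
      simp [h2, hx]
    · refine Submodule.linearMap_qext _ (LinearMap.ext fun x => ?_)
      have h1 : g (α x) = φ ((LinearMap.range j).mkQ x) := LinearMap.congr_fun hα x
      simp only [LinearMap.comp_apply, Submodule.mkQ_apply, Submodule.liftQ_apply,
        LinearMap.sub_apply, map_sub, hfg.apply_apply_eq_zero, sub_zero]
      exact h1
  obtain ⟨e, s₂, r₂, hr₂⟩ := hC₁
  -- Maps to `DΛ` separate the points of `X/Λ`; they factor through `C₁`, which embeds in a power of
  -- `Q`.
  obtain ⟨l, h, hh⟩ := exists_injective_pow (R := Λ) (X := X ⧸ LinearMap.range j) (W := Q) (by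
    intro x hx
    obtain ⟨φ, hφ⟩ := exists_ne_zero_coextendScalars hJ
      (ModuleCat.of Λ (X ⧸ LinearMap.range j)) x hx
    obtain ⟨φ', rfl⟩ := hlift φ
    by_contra! hcon
    refine hφ ?_
    have h1 : s₂ (φ' x) = 0 := funext fun z => hq (funext fun z' => by
      simpa using hcon (LinearMap.proj z' ∘ₗ q ∘ₗ LinearMap.proj z ∘ₗ s₂ ∘ₗ φ'))
    have h2 : φ' x = 0 := by rw [← hr₂ (φ' x), h1, map_zero]
    rw [LinearMap.comp_apply, h2, map_zero])
  have hY : Module.Projective Λ (Fin l → Q) := projective_pi _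
  exact two_le_domDim (ModuleCat.of Λ Λ) j hj h hh

end Backward

/-! ### The first two terms of the minimal resolution -/

section Resolution

variable {R : Type u} [Ring R]

/-- The terms of an injective resolution are a priori arbitrary modules; here they are projective
with a finitely generated essential submodule, so `finite_of_essential` applies. -/
theorem exists_resolution_of_isAuslanderGorenstein [IsArtinianRing R]
    (h : IsAuslanderGorenstein R 1) :
    HasInjectiveDimensionLT (ModuleCat.of R R) 3 ∧
    ∃ (I₀ I₁ : ModuleCat.{u} R) (i : R →ₗ[R] I₀) (d : I₀ →ₗ[R] I₁),
      (Module.Finite R I₀ ∧ Module.Projective R I₀ ∧ Module.Injective R I₀) ∧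
      (Module.Finite R I₁ ∧ Module.Projective R I₁ ∧ Module.Injective R I₁) ∧
      Function.Injective i ∧ Function.Exact i d := by
  refine ⟨(injectiveDimension_le_iff _ 2).1 h.1, ?_⟩
  obtain ⟨I, hI, h0, h1⟩ := (two_le_domDim_iff _).1 (show 2 ≤ domDim (ModuleCat.of R R) from h.2)
  obtain ⟨i, hi, hid, hess⟩ := isInjectiveEnvelope_zero I hI
  have p0 : Module.Projective R (I.cocomplex.X 0) := (IsProjective.iff_projective _).2 h0
  have p1 : Module.Projective R (I.cocomplex.X 1) := (IsProjective.iff_projective _).2 h1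
  have f0 : Module.Finite R (I.cocomplex.X 0) := finite_of_essential i hess
  have f1 : Module.Finite R (I.cocomplex.X 1) := by
    refine finite_of_essential (I.cocomplex.d 0 1).hom ?_
    rw [← LinearMap.exact_iff.1 (resolution_exact I 0)]
    exact hI 1
  exact ⟨_, _, i, (I.cocomplex.d 0 1).hom, ⟨f0, p0, inferInstance⟩, ⟨f1, p1, inferInstance⟩, hi, hid⟩

theorem exact_rangeRestrict {A B C : Type u} [AddCommGroup A] [Module R A] [AddCommGroup B]
    [Module R B] [AddCommGroup C] [Module R C] {f : A →ₗ[R] B} {g : B →ₗ[R] C}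
    (h : Function.Exact f g) : Function.Exact f g.rangeRestrict := fun x => by
  rw [← h x]
  exact ⟨fun hx => congrArg Subtype.val hx, fun hx => Subtype.ext hx⟩

theorem injective_quotient_range {A B C : Type u} [AddCommGroup A] [Module R A] [AddCommGroup B]
    [Module R B] [AddCommGroup C] [Module R C] [Module.Injective R B] [Module.Injective R C]
    {f : A →ₗ[R] B} {g : B →ₗ[R] C} (hf : Function.Injective f) (h : Function.Exact f g)
    (hA : HasInjectiveDimensionLT (ModuleCat.of R A) 3) :
    Module.Injective R (C ⧸ LinearMap.range g) :=
  injective_of_hasInjectiveDimensionLT_one (hasInjectiveDimensionLT_of_exact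
    (LinearMap.range g).subtype (LinearMap.range g).mkQ (Submodule.subtype_injective _)
    (LinearMap.exact_subtype_mkQ _) (Submodule.mkQ_surjective _)
    (hasInjectiveDimensionLT_of_exact f g.rangeRestrict hf (exact_rangeRestrict h)
      g.surjective_rangeRestrict hA))

end Resolution

/-! ### Basic modules and the sum of the projective-injectives -/

section Basic

variable {R : Type u} [Ring R]

theorem IsRetract.single {κ : Type} (F : κ → Type u) [∀ i, AddCommGroup (F i)]
    [∀ i, Module R (F i)] (j : κ) : IsRetract R (F j) (∀ i, F i) :=
  (IsRetract.of_equiv (LinearEquiv.funUnique Unit R (F j)).symm).trans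
    (IsRetract.proj_comp (F := F) (fun _ : Unit => j) fun _ _ _ => rfl)

theorem exists_isBasic (M : ModuleCat.{u} R) [IsNoetherian R M] [IsArtinian R M] :
    ∃ T : ModuleCat.{u} R, IsBasic T ∧ IsRetract R T M ∧ InAdd R T M := by
  obtain ⟨n, N, hN, ⟨e⟩⟩ := exists_equiv_pi_isIndec M
  obtain ⟨t, ε, -, hε, hε'⟩ := exists_representatives N fun _ => True
  refine ⟨ModuleCat.of R (∀ j, N (ε j)), ⟨t, fun j => N (ε j),
    fun j => (indecomposable_iff _).2 (hN _), hε, ⟨Iso.refl _⟩⟩, ?_, ?_⟩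
  · exact (IsRetract.proj_comp (F := fun i => N i) ε
      fun i j h => hε i j ⟨eqToIso (congrArg N h)⟩).trans (IsRetract.of_equiv e.symm)
  · refine (InAdd.pi fun i => ?_).of_retract (IsRetract.of_equiv e)
    obtain ⟨j, ⟨u⟩⟩ := hε' i trivial
    exact ((IsRetract.of_equiv u.toLinearEquiv).trans
      (IsRetract.single (fun j => N (ε j)) j)).inAdd

theorem inAdd_self_of_projective (M : Type u) [AddCommGroup M] [Module R M] [Module.Finite R M]
    [Module.Projective R M] : InAdd R R M := by
  obtain ⟨n, f, hf⟩ := Module.Finite.exists_fin' R M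
  exact ⟨n, isRetract_of_surjective f hf⟩

theorem exists_isSumOfProjInj [IsArtinianRing R] :
    ∃ Q : ModuleCat.{u} R, IsSumOfProjInj Q ∧ ∀ M : ModuleCat.{u} R, Module.Finite R M →
      Module.Projective R M → Module.Injective R M → InAdd R Q M := by
  obtain ⟨n, N, hN, ⟨e⟩⟩ := exists_equiv_pi_isIndec (ModuleCat.of R R)
  obtain ⟨t, ε, hp, hε, hε'⟩ := exists_representatives N fun i => Module.Injective R (N i)
  have hret : ∀ i, IsRetract R (N i) R := fun i =>
    (IsRetract.single (fun i => N i) i).trans (IsRetract.of_equiv e.symm)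
  -- An indecomposable finitely generated projective is a summand of a power of `R`, hence
  -- isomorphic to some `N i`; so the injective `N i` represent all the classes.
  have key : ∀ M : ModuleCat.{u} R, IsIndec R M → Module.Finite R M → Module.Projective R M →
      Module.Injective R M → ∃ j, Nonempty (M ≅ N (ε j)) := by
    intro M hM _ _ _
    obtain ⟨m, hm⟩ := inAdd_self_of_projective (R := R) M
    obtain ⟨-, h1⟩ := hM.exists_isRetract_of_pi hm
    obtain ⟨i, h2⟩ := hM.exists_isRetract_of_pi (h1.trans (IsRetract.of_equiv e))
    have := hM.1
    obtain ⟨v⟩ := h2.nonempty_equiv_of_isIndec (hN i)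
    obtain ⟨j, ⟨w⟩⟩ := hε' i (IsRetract.of_equiv v.symm).injective
    exact ⟨j, ⟨v.toModuleIso ≪≫ w⟩⟩
  refine ⟨ModuleCat.of R (∀ j, N (ε j)), ⟨t, fun j => N (ε j), fun j => ⟨(hret _).finite,
    (indecomposable_iff _).2 (hN _), projective_of_isRetract (hret _), ?_⟩, hε, ?_,
    ⟨Iso.refl _⟩⟩, ?_⟩
  · have := hp j
    exact Module.injective_object_of_injective_module R (N (ε j))
  · rintro M ⟨h1, h2, h3, h4⟩
    exact key M ((indecomposable_iff M).1 h2) h1 ((IsProjective.iff_projective M).2 h3)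
      (Module.injective_module_of_injective_object R M)
  · intro M _ _ _
    obtain ⟨m, L, hL, ⟨f⟩⟩ := exists_equiv_pi_isIndec M
    refine (InAdd.pi fun i => ?_).of_retract (IsRetract.of_equiv f)
    have hr : IsRetract R (L i) M :=
      (IsRetract.single (fun i => L i) i).trans (IsRetract.of_equiv f.symm)
    obtain ⟨j, ⟨v⟩⟩ := key (L i) (hL i) hr.finite hr.projective hr.injective
    exact ((IsRetract.of_equiv v.toLinearEquiv).trans
      (IsRetract.single (fun j => N (ε j)) j)).inAdd

theorem InAdd.isGeneratedBy {Q M N : ModuleCat.{u} R} (h : InAdd R Q M) (f : M →ₗ[R] N)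
    (hf : Function.Surjective f) : IsGeneratedBy Q N := by
  obtain ⟨m, i, r, hr⟩ := h
  exact ⟨m, f ∘ₗ r, hf.comp fun x => ⟨i x, hr x⟩⟩

theorem InAdd.isCogeneratedBy {Q M N : ModuleCat.{u} R} (h : InAdd R Q M) (f : N →ₗ[R] M)
    (hf : Function.Injective f) : IsCogeneratedBy Q N := by
  obtain ⟨m, i, r, hr⟩ := h
  exact ⟨m, i ∘ₗ f, (Function.LeftInverse.injective hr).comp hf⟩

end Basic

/-! ### Projective dimension, injective dimension and Ext -/

section Dimension

variable {R : Type u} [Ring R] {A B C D : Type u} [AddCommGroup A] [Module R A] [AddCommGroup B]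
    [Module R B] [AddCommGroup C] [Module R C] [AddCommGroup D] [Module R D]

theorem exists_exact_prod_right (f : A →ₗ[R] B) (g : B →ₗ[R] C) (hf : Function.Injective f)
    (h : Function.Exact f g) (hg : Function.Surjective g) :
    ∃ (f' : A →ₗ[R] D × B) (g' : D × B →ₗ[R] D × C), Function.Injective f' ∧
      Function.Exact f' g' ∧ Function.Surjective g' := by
  refine ⟨LinearMap.inr R D B ∘ₗ f, LinearMap.id.prodMap g, fun x y hxy => hf (congrArg Prod.snd hxy),
    fun x => ⟨fun hx => ?_, ?_⟩, fun y => ?_⟩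
  · obtain ⟨a, ha⟩ := (h x.2).1 (congrArg Prod.snd hx)
    exact ⟨a, Prod.ext (congrArg Prod.fst hx).symm ha⟩
  · rintro ⟨a, rfl⟩
    simp [h.apply_apply_eq_zero]
  · obtain ⟨b, hb⟩ := hg y.2
    exact ⟨(y.1, b), Prod.ext rfl hb⟩

theorem exists_exact_prod_left (f : A →ₗ[R] B) (g : B →ₗ[R] C) (hf : Function.Injective f)
    (h : Function.Exact f g) (hg : Function.Surjective g) :
    ∃ (f' : D × A →ₗ[R] D × B) (g' : D × B →ₗ[R] C), Function.Injective f' ∧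
      Function.Exact f' g' ∧ Function.Surjective g' := by
  refine ⟨LinearMap.id.prodMap f, g ∘ₗ LinearMap.snd R D B,
    fun x y hxy => ?_, fun x => ⟨fun hx => ?_, ?_⟩, fun y => ?_⟩
  · have h1 : x.1 = y.1 := by simpa using (Prod.ext_iff.1 hxy).1
    have h2 : f x.2 = f y.2 := (Prod.ext_iff.1 hxy).2
    exact Prod.ext h1 (hf h2)
  · obtain ⟨a, ha⟩ := (h x.2).1 hx
    exact ⟨(x.1, a), Prod.ext rfl ha⟩
  · rintro ⟨a, rfl⟩
    simp [h.apply_apply_eq_zero]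
  · obtain ⟨b, hb⟩ := hg y
    exact ⟨(0, b), hb⟩

theorem hasProjectiveDimensionLT_two_of_exact (f : A →ₗ[R] B) (g : B →ₗ[R] C)
    (hf : Function.Injective f) (h : Function.Exact f g) (hg : Function.Surjective g)
    [Module.Projective R A] [Module.Projective R B] :
    HasProjectiveDimensionLT (ModuleCat.of R C) 2 := by
  have hA : Projective (ModuleCat.of R A) := (IsProjective.iff_projective A).1 inferInstance
  have hB : Projective (ModuleCat.of R B) := (IsProjective.iff_projective B).1 inferInstance
  exact (exists_shortExact f g hf h hg).hasProjectiveDimensionLT_X₃ 1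
    (inferInstanceAs (HasProjectiveDimensionLT (ModuleCat.of R A) 1))
    (inferInstanceAs (HasProjectiveDimensionLT (ModuleCat.of R B) (1 + 1)))

theorem hasInjectiveDimensionLT_two_of_exact (f : A →ₗ[R] B) (g : B →ₗ[R] C)
    (hf : Function.Injective f) (h : Function.Exact f g) (hg : Function.Surjective g)
    [Module.Injective R B] [Module.Injective R C] :
    HasInjectiveDimensionLT (ModuleCat.of R A) 2 := by
  have hB : Injective (ModuleCat.of R B) := Module.injective_object_of_injective_module R B
  have hC : Injective (ModuleCat.of R C) := Module.injective_object_of_injective_module R C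
  exact ((exists_shortExact f g hf h hg).hasInjectiveDimensionLT_X₃_iff 0 hB).1
    (inferInstanceAs (HasInjectiveDimensionLT (ModuleCat.of R C) 1))

/-- In the long exact sequence, `Ext¹(M, C)` lies between `Ext¹(M, B) = 0` and `Ext²(M, A) = 0`. -/
theorem subsingleton_ext_of_exact (M : ModuleCat.{u} R) (f : A →ₗ[R] B) (g : B →ₗ[R] C)
    (hf : Function.Injective f) (h : Function.Exact f g) (hg : Function.Surjective g)
    [Module.Injective R B] (hM : HasProjectiveDimensionLT M 2) :
    Subsingleton (Abelian.Ext M (ModuleCat.of R C) 1) := by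
  have hB : Injective (ModuleCat.of R B) := Module.injective_object_of_injective_module R B
  have hB' : HasInjectiveDimensionLT (ModuleCat.of R B) 1 := inferInstance
  refine subsingleton_of_forall_eq 0 fun x => ?_
  obtain ⟨y, rfl⟩ := Abelian.Ext.covariant_sequence_exact₃ M (exists_shortExact f g hf h hg) x
    (n₁ := 2) rfl (Abelian.Ext.eq_zero_of_hasProjectiveDimensionLT _ 2 le_rfl)
  have hy : y = 0 :=
    Abelian.Ext.eq_zero_of_hasInjectiveDimensionLT (X := ModuleCat.of R B) y 1 le_rfl
  rw [hy, Abelian.Ext.zero_comp]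

theorem subsingleton_ext_of_retract {M X Y : ModuleCat.{u} R} (ρ : Retract X Y) (n : ℕ)
    (h : Subsingleton (Abelian.Ext M Y n)) : Subsingleton (Abelian.Ext M X n) := by
  refine subsingleton_of_forall_eq 0 fun x => ?_
  rw [← x.comp_mk₀_id, ← ρ.retract, ← Abelian.Ext.mk₀_comp_mk₀,
    ← Abelian.Ext.comp_assoc_of_third_deg_zero,
    h.elim (x.comp _ _) 0, Abelian.Ext.zero_comp]

end Dimension

/-! ### Kernels of covers of direct summands -/

section Cover

variable {R : Type u} [Ring R] {B W D : Type u} [AddCommGroup B] [Module R B]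
  [AddCommGroup W] [Module R W] [AddCommGroup D] [Module R D]

/-- If `D` is a summand of `W` and `π : B → W` is an epimorphism with `B` projective, then the kernel
of the composite map `B → D` is a summand of `ker π × (B × B)`. -/
theorem isRetract_ker_comp [Module.Projective R B] (π : B →ₗ[R] W) (hπ : Function.Surjective π)
    (ι : D →ₗ[R] W) (q : W →ₗ[R] D) (hq : ∀ x, q (ι x) = x) :
    IsRetract R (LinearMap.ker (q ∘ₗ π)) (LinearMap.ker π × (B × B)) := by
  -- `F` covers the two complementary summands of `W` separately, so `ker (q ∘ π)` is a summand of
  -- `ker F`. The maps `F` and `π` factor through each other, the latter by the diagonal, and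
  -- Schanuel's lemma compares their kernels.
  let F : B × B →ₗ[R] W :=
    (ι ∘ₗ q ∘ₗ π).coprod (π - ι ∘ₗ q ∘ₗ π)
  obtain ⟨h, hh⟩ := Module.projective_lifting_property π F hπ
  obtain ⟨e⟩ := nonempty_ker_prod_equiv F π h (LinearMap.id.prod LinearMap.id)
    (LinearMap.congr_fun hh) (fun y => by simp [F])
  have h1 : IsRetract R (LinearMap.ker (q ∘ₗ π)) (LinearMap.ker F) := by
    refine ⟨LinearMap.codRestrict _ (LinearMap.inl R B B ∘ₗ Submodule.subtype _) ?_,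
      LinearMap.codRestrict _ (LinearMap.fst R B B ∘ₗ Submodule.subtype _) ?_, fun _ => rfl⟩
    · rintro ⟨x, hx⟩
      have hx' : q (π x) = 0 := hx
      simp [F, hx']
    · rintro ⟨x, hx⟩
      have hx' : F x = 0 := hx
      have := congrArg q hx'
      simpa [F, hq] using this
  exact (h1.trans IsRetract.fst).trans (IsRetract.of_equiv e)

end Cover

/-! ### From the Auslander–Gorenstein property to a tilting-cotilting module -/

section Forward

variable {R : Type u} [Ring R]

/-- A finitely generated injective module is a summand of a finite power of `W`, provided that `W`
is an injective module containing every simple module. -/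
theorem inAdd_of_cogenerator [IsArtinianRing R] {W : Type u} [AddCommGroup W] [Module R W]
    [Module.Injective R W]
    (hW : ∀ S : ModuleCat.{u} R, IsSimpleModule R S → ∃ φ : S →ₗ[R] W, φ ≠ 0)
    (D : Type u) [AddCommGroup D] [Module R D] [Module.Finite R D] [Module.Injective R D] :
    InAdd R W D := by
  obtain ⟨m, f, hf⟩ := exists_injective_pow (R := R) (X := D) (W := W) (by
    intro x hx
    have : Nontrivial (Submodule.span R {x}) := by
      rw [Submodule.nontrivial_iff_ne_bot]
      simpa using hx
    -- A nonzero map from a simple submodule of the span of `x` extends to `D`, and cannot vanish at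
    -- the generator `x`.
    obtain ⟨S, hS⟩ := exists_simple_submodule (R := R) (M := Submodule.span R {x})
    obtain ⟨φ, hφ⟩ := hW (ModuleCat.of R S) hS
    obtain ⟨g, hg⟩ := Module.Injective.out ((Submodule.span R {x}).subtype ∘ₗ S.subtype)
      ((Submodule.subtype_injective _).comp (Submodule.subtype_injective _)) φ
    refine ⟨g, fun h0 => hφ (LinearMap.ext fun s => ?_)⟩
    have h1 := hg s
    obtain ⟨r, hr⟩ := Submodule.mem_span_singleton.1 s.1.2
    rw [← h1]
    have h2 : ((Submodule.span R {x}).subtype ∘ₗ S.subtype) s = r • x := hr.symm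
    rw [h2, map_smul, h0, smul_zero]
    rfl)
  exact ⟨m, isRetract_of_injective f hf⟩

theorem nonempty_ker_pi_equiv {B W : Type u} [AddCommGroup B] [Module R B] [AddCommGroup W]
    [Module R W] (π : B →ₗ[R] W) (m : ℕ) :
    Nonempty (LinearMap.ker (LinearMap.pi fun a : Fin m => π ∘ₗ LinearMap.proj a) ≃ₗ[R]
      (Fin m → LinearMap.ker π)) :=
  ⟨LinearEquiv.ofLinearMap
    (LinearMap.pi fun a => LinearMap.codRestrict _
      ((LinearMap.proj a : (Fin m → B) →ₗ[R] B) ∘ₗ Submodule.subtype _)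
      fun x => LinearMap.mem_ker.2 (congrFun (LinearMap.mem_ker.1 x.2) a))
    (LinearMap.codRestrict _ (LinearMap.pi fun a => Submodule.subtype _ ∘ₗ LinearMap.proj a)
      fun x => funext fun a => (x a).2)
    (LinearMap.ext fun _ => rfl) (LinearMap.ext fun _ => rfl)⟩

/-- If `D` is a summand of a power of `W` and `π : B → W` is an epimorphism with `B` projective,
then `D` has a resolution by modules in the additive closure of `T`, provided that the latter
contains `B` and the kernel of `π`. -/
theorem exists_resolution_of_inAdd {T B W D : Type u} [AddCommGroup T] [Module R T]
    [AddCommGroup B] [Module R B] [AddCommGroup W] [Module R W] [AddCommGroup D] [Module R D]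
    [Module.Projective R B] (π : B →ₗ[R] W) (hπ : Function.Surjective π) (hB : InAdd R T B)
    (hK : InAdd R T (LinearMap.ker π)) (hD : InAdd R W D) :
    ∃ (C₀ C₁ : ModuleCat.{u} R) (f : C₀ →ₗ[R] C₁) (g : C₁ →ₗ[R] D),
      InAdd R T C₀ ∧ InAdd R T C₁ ∧
      Function.Injective f ∧ Function.Exact f g ∧ Function.Surjective g := by
  obtain ⟨m, i, r, hr⟩ := hD
  let p : (Fin m → B) →ₗ[R] (Fin m → W) := LinearMap.pi fun a => π ∘ₗ LinearMap.proj a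
  have hp : Function.Surjective p := fun y =>
    ⟨fun a => (hπ (y a)).choose, funext fun a => (hπ (y a)).choose_spec⟩
  have hP : Module.Projective R (Fin m → B) := projective_pi _
  obtain ⟨e⟩ := nonempty_ker_pi_equiv π m
  have hBm : InAdd R T (Fin m → B) := InAdd.pi fun _ => hB
  refine ⟨ModuleCat.of R (LinearMap.ker (r ∘ₗ p)), ModuleCat.of R (Fin m → B),
    Submodule.subtype _, r ∘ₗ p, ?_, hBm, Submodule.subtype_injective _,
    LinearMap.exact_subtype_ker_map _, fun x => ?_⟩
  · refine InAdd.of_retract (InAdd.prod ?_ (hBm.prod hBm)) (isRetract_ker_comp p hp i r hr)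
    exact (InAdd.pi fun _ => hK).of_retract (IsRetract.of_equiv e)
  · obtain ⟨y, hy⟩ := hp (i x)
    exact ⟨y, by rw [LinearMap.comp_apply, hy, hr]⟩

theorem isRetract_ker_prodMap {A B C : Type u} [AddCommGroup A] [Module R A]
    [AddCommGroup B] [Module R B] [AddCommGroup C] [Module R C] (f : B →ₗ[R] C) :
    IsRetract R (LinearMap.ker ((LinearMap.id : A →ₗ[R] A).prodMap f)) (LinearMap.ker f) := by
  refine ⟨LinearMap.codRestrict _ (LinearMap.snd R A B ∘ₗ Submodule.subtype _)
    fun x => congrArg Prod.snd x.2,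
    LinearMap.codRestrict _ (LinearMap.inr R A B ∘ₗ Submodule.subtype _) fun x => ?_, fun x => ?_⟩
  · simp
  · have h1 : x.1.1 = 0 := congrArg Prod.fst x.2
    exact Subtype.ext (Prod.ext h1.symm rfl)

variable {k : Type u} [CommRing k] {Λ : Type u} [Ring Λ] [Algebra k Λ]

theorem exists_of_isAuslanderGorenstein [IsArtinianRing k] [Module.Finite k Λ]
    [IsArtinianRing Λ] (h : IsAuslanderGorenstein Λ 1) :
    ∃ T : ModuleCat.{u} Λ, IsInC T ∧ IsTilting T ∧ IsCotilting k T := by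
  obtain ⟨hdim, I₀, I₁, i, d, ⟨f0, p0, j0⟩, ⟨f1, p1, j1⟩, hi, hd⟩ :=
    exists_resolution_of_isAuslanderGorenstein h
  let K := LinearMap.range d
  have hC : Module.Injective Λ (I₁ ⧸ K) := injective_quotient_range hi hd hdim
  have hd' : Function.Exact i d.rangeRestrict := exact_rangeRestrict hd
  have hds : Function.Surjective d.rangeRestrict := d.surjective_rangeRestrict
  have hKf : Module.Finite Λ K := Module.Finite.of_surjective _ hds
  obtain ⟨T, hbasic, hret, hadd⟩ := exists_isBasic (ModuleCat.of Λ (I₀ × K))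
  obtain ⟨ρ⟩ := hret.retract
  have hTf : Module.Finite Λ T := hret.finite
  have hT0 : InAdd Λ T I₀ := hadd.of_retract IsRetract.fst
  have hTK : InAdd Λ T K := hadd.of_retract IsRetract.snd
  -- `I₁` is a summand of some `Λⁿ`, which embeds in `I₀ⁿ`; being injective, `I₁` splits off there.
  have hT1 : InAdd Λ T I₁ := by
    obtain ⟨n, s⟩ := inAdd_self_of_projective (R := Λ) I₁
    obtain ⟨s, r, hr⟩ := s
    exact hT0.trans ⟨n, isRetract_of_injective (LinearMap.pi (fun a => i ∘ₗ LinearMap.proj a) ∘ₗ s)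
      ((Function.Injective.comp (g := LinearMap.pi (fun a => i ∘ₗ LinearMap.proj a))
        (fun x y h => funext fun a => hi (congrFun h a)) (Function.LeftInverse.injective hr)))⟩
  -- The sequences `0 → Λ → I₀ × I₀ → I₀ × K → 0` and `0 → I₀ × K → I₀ × I₁ → I₁/K → 0` bound the
  -- two dimensions of `T`, and also place `T` in `Gen Q` and `Cogen Q`.
  obtain ⟨a, b, ha, hab, hb⟩ := exists_exact_prod_right (D := I₀) i d.rangeRestrict hi hd' hds
  obtain ⟨a', b', ha', hab', hb'⟩ := exists_exact_prod_left (D := I₀) K.subtype K.mkQ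
    K.subtype_injective (LinearMap.exact_subtype_mkQ _) K.mkQ_surjective
  have hpd : HasProjectiveDimensionLT T 2 :=
    have := hasProjectiveDimensionLT_two_of_exact a b ha hab hb
    ρ.hasProjectiveDimensionLT 2
  have hid : HasInjectiveDimensionLT T 2 :=
    have := hasInjectiveDimensionLT_two_of_exact a' b' ha' hab' hb'
    ρ.hasInjectiveDimensionLT 2
  have hext : Subsingleton (Abelian.Ext T T 1) :=
    subsingleton_ext_of_retract ρ 1 (subsingleton_ext_of_exact T a b ha hab hb hpd)
  refine ⟨T, ⟨hTf, ?_⟩, ⟨hTf, hbasic, ?_, hext, ?_⟩, ⟨hTf, ?_, hext, ?_⟩⟩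
  · obtain ⟨Q, hQ, hQadd⟩ := exists_isSumOfProjInj (R := Λ)
    obtain ⟨s, r, hr⟩ := hret
    refine ⟨Q, hQ, ?_, ?_⟩
    · exact InAdd.isGeneratedBy (M := ModuleCat.of Λ (I₀ × I₀))
        ((hQadd I₀ f0 p0 j0).prod (hQadd I₀ f0 p0 j0)) (r ∘ₗ b)
        (Function.Surjective.comp (g := r) (fun x => ⟨s x, hr x⟩) hb)
    · exact InAdd.isCogeneratedBy (M := ModuleCat.of Λ (I₀ × I₁))
        ((hQadd I₀ f0 p0 j0).prod (hQadd I₁ f1 p1 j1)) (a' ∘ₗ s)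
        (ha'.comp (Function.LeftInverse.injective hr))
  · exact (projectiveDimension_le_iff T 1).2 hpd
  · exact ⟨I₀, ModuleCat.of Λ K, i, d.rangeRestrict, (isInAdd_iff _ _).2 hT0,
      (isInAdd_iff _ _).2 hTK, hi, hd', hds⟩
  · exact (injectiveDimension_le_iff T 1).2 hid
  · obtain ⟨J, hJ⟩ := exists_isInjectiveEnvelope (ModuleCat.of k (k ⧸ Ring.jacobson k))
    have hJi : Module.Injective k J := hJ.1
    have hJf : Module.Finite k J := finite_of_isInjectiveEnvelope hJ
    have hDi : Module.Injective Λ ((ModuleCat.coextendScalars (algebraMap k Λ)).obj J) :=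
      injective_coextendScalars J
    have hDf : Module.Finite Λ ((ModuleCat.coextendScalars (algebraMap k Λ)).obj J) :=
      finite_coextendScalars J
    have hD := inAdd_of_cogenerator (R := Λ) (W := (I₀ × I₁) × (I₁ ⧸ K)) (by
      intro S hS
      obtain ⟨φ, hφ⟩ | ⟨φ, hφ⟩ | ⟨φ, hφ⟩ :=
        exists_ne_zero_of_resolution k I₀ I₁ i d hi hd hdim S hS
      · exact ⟨LinearMap.inl _ _ _ ∘ₗ LinearMap.inl _ _ _ ∘ₗ φ, fun h0 => hφ
          (LinearMap.ext fun x => congrArg (fun y => y.1.1) (LinearMap.congr_fun h0 x))⟩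
      · exact ⟨LinearMap.inl _ _ _ ∘ₗ LinearMap.inr _ _ _ ∘ₗ φ, fun h0 => hφ
          (LinearMap.ext fun x => congrArg (fun y => y.1.2) (LinearMap.congr_fun h0 x))⟩
      · exact ⟨LinearMap.inr _ _ _ ∘ₗ φ, fun h0 => hφ
          (LinearMap.ext fun x => congrArg (fun y => y.2) (LinearMap.congr_fun h0 x))⟩)
      ((ModuleCat.coextendScalars (algebraMap k Λ)).obj J)
    -- The kernel of `(I₀ × I₁) × I₁ → (I₀ × I₁) × I₁/K` is a copy of `K`, so this cover resolves
    -- `DΛ` inside `add T`.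
    have hker : InAdd Λ T (LinearMap.ker ((LinearMap.id : (I₀ × I₁) →ₗ[Λ] _).prodMap K.mkQ)) := by
      refine hTK.of_retract ((isRetract_ker_prodMap K.mkQ).trans ?_)
      rw [Submodule.ker_mkQ]
      exact IsRetract.refl
    obtain ⟨C₀, C₁, f, g, h0, h1, hf, hfg, hg⟩ := exists_resolution_of_inAdd
      ((LinearMap.id : (I₀ × I₁) →ₗ[Λ] _).prodMap K.mkQ)
      (Function.Surjective.prodMap Function.surjective_id K.mkQ_surjective)
      ((hT0.prod hT1).prod hT1) hker hD
    exact ⟨J, hJ, C₀, C₁, f, g, (isInAdd_iff _ _).2 h0, (isInAdd_iff _ _).2 h1, hf, hfg, hg⟩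

end Forward

end ArtinAlgebra

theorem mainTheorem4 (k : Type u) [CommRing k] [IsArtinianRing k]
    (Λ : Type u) [Ring Λ] [Algebra k Λ] [Module.Finite k Λ] :
    (∃ T : ModuleCat.{u} Λ, ArtinAlgebra.IsInC T ∧
      ArtinAlgebra.IsTilting T ∧ ArtinAlgebra.IsCotilting k T) ↔
    ArtinAlgebra.IsAuslanderGorenstein Λ 1 := by
  have : IsArtinianRing Λ := IsArtinianRing.of_finite k Λ
  exact ⟨fun ⟨_, hC, hT, hcT⟩ => ArtinAlgebra.isAuslanderGorenstein_of_exists hC hT hcT,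
    ArtinAlgebra.exists_of_isAuslanderGorenstein⟩
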